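/- **Setting.** For a matrix $A$ with $n$ rows let $Q(A)=I_n-A(A'A)^{-1}A'$, let $\|A\|=\sqrt{\lambda_{\max}(A'A)}$ (the Euclidean norm for vectors) and $\|A\|_\infty=\max_i\sum_j|a_{ij}|$; let $\mathbb 1_n$ be the $n$-vector of ones. Let $p,q\ge 0$ be fixed integers. For $m$ tests and $n$ observations consider the linear factor model $$Y=\mathbb 1_n\alpha'+XB+Z\Gamma+E\in\mathbb R^{n\times m},$$ where $\alpha\in\mathbb R^m$, $B\in\mathbb R^{p\times m}$, $\Gamma=(\gamma_1,\dots,\gamma_m)\in\mathbb R^{q\times m}$, and $X,Z,E$ have rows $x_i'\in\mathbb R^p$, $z_i'\in\mathbb R^q$, $\varepsilon_i'\in\mathbb R^m$ $(i\le n)$. The parameters $\alpha,B,\Gamma$ are constants or random variables independent of $\{x_i,z_i,\varepsilon_i\}_{i\le n}$; conditions on random quantities are meant almost surely. The hypotheses tested are $H_{0j}:\alpha_j=0$ versus $\alpha_j\ne0$; $\mathcal I_0=\{j:\alpha_j=0\}$ and $\mathcal I_1$ is its complement, with cardinalities $m_0$ and $m_1$. Put $\tilde X=(\mathbb 1_n,X)$,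 $c_n=\sqrt{\mathbb 1_n'Q(X)\mathbb 1_n}$, $\vartheta=Y'Q(X)\mathbb 1_n/c_n$, $\zeta=Z'Q(X)\mathbb 1_n/c_n$. **Conditions.** There are a positive definite $q\times q$ matrix $\Sigma_\gamma$ and constants $0<b_{\min}\le b_{\max}<\infty$, $h<1$ (not depending on $m,n$) such that - (C1) all eigenvalues of $\tilde X'\tilde X/n$ lie in $[b_{\min},b_{\max}]$; - (C2) the vectors $(z_i',\varepsilon_i')$, $i\le n$, are i.i.d. $N(0,\mathrm{diag}\{I_q,\Sigma_\varepsilon\})$ and, jointly, independent of $X$; - (C3) $|\alpha_j|\ge b_{\min}$ for $j\in\mathcal I_1$, $\|Q(\mathbb 1_m)\alpha\|=O(m^h)$ and $\|\Gamma Q(\mathbb 1_m)\alpha\|=o(m/\sqrt n)$; - (C4) $\|\gamma_j\|\le b_{\max}$ for $j\le m$ and $\|\Gamma Q(\mathbb 1_m)\Gamma'/m-\Sigma_\gamma\|\to0$; - (C5) $\|\Sigma_\varepsilon\|_\infty\le b_{\max}$ and $b_{\min}\le\sigma_{\varepsilon,jj}\le b_{\max}$ for $j\le m$; - (C6) $b_{\min}\le|\alpha_j|\le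 b_{\max}$ for $j\in\mathcal I_1$. Assumption 1 consists of (C1)–(C5); Assumption 2 consists of (C1), (C2), (C6), (C4), (C5). **Oracle procedure.** Let $T_{ora}=\Lambda_\varepsilon^{-1/2}(\vartheta-\Gamma'\zeta)$ with $\Lambda_\varepsilon=\mathrm{diag}(\sigma_{\varepsilon,11},\dots,\sigma_{\varepsilon,mm})$, let $p_j=2\Phi(-|t_{ora,j}|)$ be the p-values, and let $V(t),S(t),R(t)$ be the numbers of $j$ in $\mathcal I_0$, in $\mathcal I_1$ and in $\{1,\dots,m\}$, respectively, with $p_j\le t$. Put $$\mathrm{FDP}_{ora}(t)=\frac{V(t)}{\max\{R(t),1\}},\qquad \mathrm{POW}_{ora}(t)=\frac{S(t)}{\max\{m_1,1\}}.$$ For $\nu\in[0,1)$ and $\tau>0$ let $$\hat\pi_0(\nu)=\frac{m-R(\nu)}{(1-\nu)m},\qquad \widehat{\mathrm{FDR}}_\nu(t)=\frac{\hat\pi_0(\nu)\,m\,t}{\max\{R(t),1\}},\qquad t^*=\sup\{t\in(0,1]:\widehat{\mathrm{FDR}}_\nu(t)\le\tau\},$$ and let $\mathrm{FDR}_{ora}(t^*)=\mathbb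 E[\mathrm{FDP}_{ora}(t^*)]$. **Proposition 1.** Let $\nu\in[0,1)$ and $\tau>0$. Consider a sequence of such models along which $\min\{m_0,m_1,n\}\to\infty$. Suppose that $m_0/m\to\pi_0$ for some $\pi_0\in[0,1]$, that $\log m=o(n)$, and that Assumption 1 or Assumption 2 holds along the sequence, with $\Sigma_\gamma$, $b_{\min}$, $b_{\max}$, $h$ fixed. Then (a) $\limsup\mathrm{FDR}_{ora}(t^*)\le\tau$; (b) $\lim\mathbb E[\mathrm{POW}_{ora}(t^*)]=1$. In particular every limiting true-null proportion $\pi_0\in[0,1]$ is allowed, including non-sparse alternatives ($\pi_0<1$). -/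

import Mathlib

open MeasureTheory ProbabilityTheory Filter Topology Asymptotics

noncomputable section

namespace FAT

/-! ### Linear algebra -/

/-- The vector of ones, as a one-column matrix. -/
def onesCol (ι : Type*) : Matrix ι Unit ℝ := Matrix.of fun _ _ => 1

/-- `Q(X) = I - X (X'X)⁻¹ X'`. -/
def Q {ι κ : Type*} [Fintype ι] [DecidableEq ι] [Fintype κ] [DecidableEq κ]
    (X : Matrix ι κ ℝ) : Matrix ι ι ℝ :=
  1 - X * (X.transpose * X)⁻¹ * X.transpose

/-- The Euclidean norm of a finite real vector. -/
def eucl {ι : Type*} [Fintype ι] (v : ι → ℝ) : ℝ := Real.sqrt (∑ i, v i ^ 2)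

/-- The maximal absolute row sum `max_i ∑_j |a_ij|`. -/
def maxRowSum {ι κ : Type*} [Fintype κ] (A : Matrix ι κ ℝ) : ℝ := ⨆ i, ∑ j, |A i j|

/-! ### Multiple testing based on a vector of p-values

`p j` is the p-value of the `j`-th test and `I₀` is the set of true nulls. -/

/-- Two-sided normal p-value `2 Φ(-|t|)` of a test statistic `t`. -/
def pValue (t : ℝ) : ℝ := 2 * cdf (gaussianReal 0 1) (-|t|)

section Testing

variable {m : ℕ}

/-- Number `V(t)` of false discoveries. -/
def V (I₀ : Finset (Fin m)) (p : Fin m → ℝ) (t : ℝ) : ℕ := (I₀.filter fun j => p j ≤ t).card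

/-- Number `S(t)` of positive discoveries. -/
def S (I₀ : Finset (Fin m)) (p : Fin m → ℝ) (t : ℝ) : ℕ := (I₀ᶜ.filter fun j => p j ≤ t).card

/-- Number `R(t)` of rejections. -/
def R (p : Fin m → ℝ) (t : ℝ) : ℕ := (Finset.univ.filter fun j => p j ≤ t).card

/-- False discovery proportion `V(t) / max {R(t), 1}`. -/
def FDP (I₀ : Finset (Fin m)) (p : Fin m → ℝ) (t : ℝ) : ℝ :=
  (V I₀ p t : ℝ) / max (R p t : ℝ) 1

/-- Power `S(t) / max {m₁, 1}`. -/
def POW (I₀ : Finset (Fin m)) (p : Fin m → ℝ) (t : ℝ) : ℝ :=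
  (S I₀ p t : ℝ) / max (I₀ᶜ.card : ℝ) 1

/-- Estimated proportion of true nulls `(m - R(ν)) / ((1 - ν) m)`. -/
def nullPropEst (ν : ℝ) (p : Fin m → ℝ) : ℝ := ((m : ℝ) - R p ν) / ((1 - ν) * m)

/-- The estimated false discovery rate. -/
def FDRest (ν : ℝ) (p : Fin m → ℝ) (t : ℝ) : ℝ :=
  nullPropEst ν p * m * t / max (R p t : ℝ) 1

/-- The threshold `t* = sup {t ∈ (0,1] : FDRest ν t ≤ τ}`. -/
def tStar (τ ν : ℝ) (p : Fin m → ℝ) : ℝ :=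
  sSup {t : ℝ | t ∈ Set.Ioc (0 : ℝ) 1 ∧ FDRest ν p t ≤ τ}

end Testing

/-! ### The linear factor model -/

/-- The ingredients of the linear factor model
`y_ij = α_j + β_j' x_i + γ_j' z_i + ε_ij` (`i ≤ n`, `j ≤ m`) with `p` explanatory variables and
`q` latent factors, on the sample space `Ω`, and the covariance matrix `Σ_ε` of the rows `ε_i`.
The parameters `α_j, β_j, γ_j` may be random; constant functions give constant parameters. -/
structure FactorModel (Ω : Type*) [MeasurableSpace Ω] (p q m n : ℕ) where
  alpha : Ω → Fin m → ℝ
  beta : Ω → Fin m → Fin p → ℝ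
  gamma : Ω → Fin m → Fin q → ℝ
  x : Ω → Fin n → Fin p → ℝ
  z : Ω → Fin n → Fin q → ℝ
  eps : Ω → Fin n → Fin m → ℝ
  covE : Matrix (Fin m) (Fin m) ℝ
  measurable_alpha : Measurable alpha
  measurable_beta : Measurable beta
  measurable_gamma : Measurable gamma
  measurable_x : Measurable x
  measurable_z : Measurable z
  measurable_eps : Measurable eps

namespace FactorModel

variable {Ω : Type*} [MeasurableSpace Ω] {p q m n : ℕ} (M : FactorModel Ω p q m n)

/-- `X`, of size `n × p`, with rows `x_i'`. -/
def X (ω : Ω) : Matrix (Fin n) (Fin p) ℝ := Matrix.of (M.x ω)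

/-- `Z`, of size `n × q`, with rows `z_i'`. -/
def Z (ω : Ω) : Matrix (Fin n) (Fin q) ℝ := Matrix.of (M.z ω)

/-- `E`, of size `n × m`, with rows `ε_i'`. -/
def E (ω : Ω) : Matrix (Fin n) (Fin m) ℝ := Matrix.of (M.eps ω)

/-- `B = (β_1, …, β_m)`, of size `p × m`. -/
def B (ω : Ω) : Matrix (Fin p) (Fin m) ℝ := (Matrix.of (M.beta ω)).transpose

/-- `Γ = (γ_1, …, γ_m)`, of size `q × m`. -/
def Gam (ω : Ω) : Matrix (Fin q) (Fin m) ℝ := (Matrix.of (M.gamma ω)).transpose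

/-- `Y = 1 α' + X B + Z Γ + E`. -/
def Y (ω : Ω) : Matrix (Fin n) (Fin m) ℝ :=
  Matrix.vecMulVec (fun _ => 1) (M.alpha ω) + M.X ω * M.B ω + M.Z ω * M.Gam ω + M.E ω

/-- `(1_n, X)`. -/
def Xtilde (ω : Ω) : Matrix (Fin n) (Unit ⊕ Fin p) ℝ :=
  Matrix.fromCols (onesCol (Fin n)) (M.X ω)

/-- `Q(X) 1_n`. -/
def QXone (ω : Ω) : Fin n → ℝ := (Q (M.X ω)).mulVec (fun _ => 1)

/-- `c_n = √(1_n' Q(X) 1_n)`. -/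
def c (ω : Ω) : ℝ := Real.sqrt ((fun _ : Fin n => (1 : ℝ)) ⬝ᵥ M.QXone ω)

/-- `ϑ = Y' Q(X) 1_n / c_n`. -/
def vartheta (ω : Ω) : Fin m → ℝ := (M.c ω)⁻¹ • (M.Y ω).transpose.mulVec (M.QXone ω)

/-- `ζ = Z' Q(X) 1_n / c_n`. -/
def zeta (ω : Ω) : Fin q → ℝ := (M.c ω)⁻¹ • (M.Z ω).transpose.mulVec (M.QXone ω)

/-- Oracle statistics `T_ora = Λ_ε^{-1/2} (ϑ - Γ' ζ)`, where `Λ_ε` is the diagonal of `Σ_ε`. -/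
def Tora (ω : Ω) (j : Fin m) : ℝ :=
  (M.vartheta ω j - (M.Gam ω).transpose.mulVec (M.zeta ω) j) / Real.sqrt (M.covE j j)

/-- p-values of the oracle procedure. -/
def pora (ω : Ω) (j : Fin m) : ℝ := pValue (M.Tora ω j)

/-- The set of true nulls `{j : α_j = 0}`. -/
def I₀ (ω : Ω) : Finset (Fin m) := Finset.univ.filter fun j => M.alpha ω j = 0

/-- Number `m₀` of true nulls. -/
def m₀ (ω : Ω) : ℕ := (M.I₀ ω).card

/-- Number `m₁` of alternatives. -/
def m₁ (ω : Ω) : ℕ := (M.I₀ ω)ᶜ.card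

/-- `FDP_ora(t*)`, with `t*` computed from the oracle p-values. -/
def fdpOra (τ ν : ℝ) (ω : Ω) : ℝ := FDP (M.I₀ ω) (M.pora ω) (tStar τ ν (M.pora ω))

/-- `POW_ora(t*)`, with `t*` computed from the oracle p-values. -/
def powOra (τ ν : ℝ) (ω : Ω) : ℝ := POW (M.I₀ ω) (M.pora ω) (tStar τ ν (M.pora ω))

/-- `FDR_ora(t*) = E[FDP_ora(t*)]`. -/
def fdrOra (P : Measure Ω) (τ ν : ℝ) : ℝ := ∫ ω, M.fdpOra τ ν ω ∂P

/-- The model parameters `(α, B, Γ)` are independent of `{x_i, z_i, ε_i}_{i ≤ n}`. -/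
def ParamIndep (P : Measure Ω) : Prop :=
  IndepFun (fun ω => (M.alpha ω, M.beta ω, M.gamma ω)) (fun ω => (M.x ω, M.z ω, M.eps ω)) P

/-- The stacked vector `(z_i', ε_i')'`. -/
def noise (i : Fin n) (ω : Ω) : EuclideanSpace ℝ (Fin q ⊕ Fin m) :=
  WithLp.toLp 2 (Sum.elim (M.z ω i) (M.eps ω i))

/-- All eigenvalues of `(1_n, X)' (1_n, X) / n` lie between `bmin` and `bmax`. -/
def Design (P : Measure Ω) (bmin bmax : ℝ) : Prop :=
  ∀ᵐ ω ∂P, ∀ l ∈ spectrum ℝ ((n : ℝ)⁻¹ • ((M.Xtilde ω).transpose * M.Xtilde ω)),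
    bmin ≤ l ∧ l ≤ bmax

/-- `(z_i', ε_i')` are i.i.d. `N(0, diag {I_q, Σ_ε})` and independent of `X`. -/
def Normality (P : Measure Ω) : Prop :=
  M.covE.PosSemidef ∧
  iIndepFun M.noise P ∧
  (∀ i, HasLaw (M.noise i) (multivariateGaussian 0 (Matrix.fromBlocks 1 0 0 M.covE)) P) ∧
  IndepFun (fun ω => (M.z ω, M.eps ω)) M.x P

/-- `‖Σ_ε‖_∞ ≤ bmax` and `bmin ≤ σ_{ε,jj} ≤ bmax` for all `j`. -/
def ErrorCov (bmin bmax : ℝ) : Prop :=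
  maxRowSum M.covE ≤ bmax ∧ ∀ j, bmin ≤ M.covE j j ∧ M.covE j j ≤ bmax

end FactorModel

/-! ### Assumptions on a sequence of factor models -/

section Assumptions

variable {Ω : Type*} [MeasurableSpace Ω] {p q : ℕ} {m n : ℕ → ℕ}

/-- `|α_j| ≥ bmin` for every alternative, `‖Q(1_m) α‖ = O(m^h)` and
`‖Γ Q(1_m) α‖ = o(m / √n)`. -/
def AlphaDispersed (P : Measure Ω) (M : ∀ N, FactorModel Ω p q (m N) (n N))
    (bmin h : ℝ) : Prop :=
  (∀ N, ∀ᵐ ω ∂P, ∀ j, j ∉ (M N).I₀ ω → bmin ≤ |(M N).alpha ω j|) ∧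
  (∀ᵐ ω ∂P, (fun N => eucl ((Q (onesCol (Fin (m N)))).mulVec ((M N).alpha ω)))
    =O[atTop] fun N => (m N : ℝ) ^ h) ∧
  (∀ᵐ ω ∂P, (fun N => eucl
      (((M N).Gam ω * Q (onesCol (Fin (m N)))).mulVec ((M N).alpha ω)))
    =o[atTop] fun N => (m N : ℝ) / Real.sqrt (n N))

/-- `bmin ≤ |α_j| ≤ bmax` for every alternative. -/
def AlphaBounded (P : Measure Ω) (M : ∀ N, FactorModel Ω p q (m N) (n N))
    (bmin bmax : ℝ) : Prop :=
  ∀ N, ∀ᵐ ω ∂P, ∀ j, j ∉ (M N).I₀ ω →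
    bmin ≤ |(M N).alpha ω j| ∧ |(M N).alpha ω j| ≤ bmax

open scoped Matrix.Norms.L2Operator in
/-- `‖γ_j‖ ≤ bmax` for all `j`, and `Γ Q(1_m) Γ' / m → Σ_γ` in spectral norm. -/
def Pervasive (P : Measure Ω) (M : ∀ N, FactorModel Ω p q (m N) (n N))
    (SigG : Matrix (Fin q) (Fin q) ℝ) (bmax : ℝ) : Prop :=
  (∀ N, ∀ᵐ ω ∂P, ∀ j, eucl ((M N).gamma ω j) ≤ bmax) ∧
  ∀ᵐ ω ∂P, Tendsto (fun N => ‖(m N : ℝ)⁻¹ •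
      ((M N).Gam ω * Q (onesCol (Fin (m N))) * ((M N).Gam ω).transpose) - SigG‖)
    atTop (𝓝 0)

/-- The first set of conditions (dispersion condition on `α`). -/
def Assumption1 (P : Measure Ω) (M : ∀ N, FactorModel Ω p q (m N) (n N))
    (SigG : Matrix (Fin q) (Fin q) ℝ) (bmin bmax h : ℝ) : Prop :=
  (∀ N, (M N).Design P bmin bmax) ∧ (∀ N, (M N).Normality P) ∧
  AlphaDispersed P M bmin h ∧ Pervasive P M SigG bmax ∧ ∀ N, (M N).ErrorCov bmin bmax

/-- The second set of conditions (bounded `α`). -/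
def Assumption2 (P : Measure Ω) (M : ∀ N, FactorModel Ω p q (m N) (n N))
    (SigG : Matrix (Fin q) (Fin q) ℝ) (bmin bmax : ℝ) : Prop :=
  (∀ N, (M N).Design P bmin bmax) ∧ (∀ N, (M N).Normality P) ∧
  AlphaBounded P M bmin bmax ∧ Pervasive P M SigG bmax ∧ ∀ N, (M N).ErrorCov bmin bmax

end Assumptions

end FAT

end

/-! The contrast `Q(X) 1` is orthogonal to the columns of `X`, and subtracting `Γ'ζ` removes the
factors exactly, so `T_j = c_n α_j / σ_j + ξ_j`. The vector `ξ` is a unit combination of the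
Gaussian errors: whatever `(α, X)` is, its law is centred normal with the correlations of `Σ_ε`,
whose absolute row sums are at most `C = bmax / bmin` (`map_prodMk_noiseComb`, `Tora_eq`).

Power: `c_n` is at least of order `√n`, while `log m = o(n)` keeps all `|ξ_j|` below half the signal
with probability tending to one. Then every alternative has a p-value far below `s = min (τ (1 - ν)
m₁ / m) 1`. At `t = s` all alternatives are rejected, so the estimated FDR is at most `τ`; hence `s
≤ t*` and the power equals one.

FDR: Gebelein's inequality (`StdPair.abs_cov_comp_le`) bounds the covariances of the null indicators
by correlations, so `Var V(t) ≤ 2 C m₀ t`. Chebyshev along the grid `(1 + δ)^k s` gives a geometric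
series of order `1 / (m₀ s)`, and `m₀ s` is at least a constant times `min m₀ m₁`, whatever `m₀ / m`
does. So `V(t) ≤ (1 + δ)² m₀ t` for all `t ≥ s` at once. Similarly `π̂₀ m ≥ (1 - δ) m₀`. Inserting
`t*` bounds the FDP by `(1 + δ)² / (1 - δ) · τ`; bounded convergence in probability and `δ → 0`
finish the argument. -/

namespace FAT

/-- A pair of jointly Gaussian standard normal variables with correlation `ρ`. -/
structure StdPair {Ω : Type*} [MeasurableSpace Ω] (X Y : Ω → ℝ) (ρ : ℝ) (P : Measure Ω) : Prop where
  gaussian : HasGaussianLaw (fun ω => (X ω, Y ω)) P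
  mean_fst : P[X] = 0
  mean_snd : P[Y] = 0
  var_fst : Var[X; P] = 1
  var_snd : Var[Y; P] = 1
  cov_eq : cov[X, Y; P] = ρ

/-! ### Bivariate standard normal laws. -/

section Pair

variable {Ω Ω' : Type*} [MeasurableSpace Ω] [MeasurableSpace Ω'] {X Y : Ω → ℝ} {X' Y' : Ω' → ℝ}
  {ρ : ℝ} {P : Measure Ω} {P' : Measure Ω'}

theorem StdPair.isProbabilityMeasure (h : StdPair X Y ρ P) : IsProbabilityMeasure P :=
  h.gaussian.isProbabilityMeasure

/-- The law of `L (X, Y)` is normal with moments fixed by `ρ`. Hence `ρ` alone determines the joint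
law, and a pair may be replaced by any convenient model. -/
theorem StdPair.charFunDual_eq (h : StdPair X Y ρ P) (L : StrongDual ℝ (ℝ × ℝ)) :
    charFunDual (P.map fun ω => (X ω, Y ω)) L =
      Complex.exp (-((L (1, 0) ^ 2 + 2 * L (1, 0) * L (0, 1) * ρ + L (0, 1) ^ 2 : ℝ) : ℂ) / 2) := by
  have := h.isProbabilityMeasure
  have hX := h.gaussian.fst.memLp_two
  have hY := h.gaussian.snd.memLp_two
  have hL : (fun ω => L (X ω, Y ω)) =
      (fun ω => L (1, 0) * X ω) + (fun ω => L (0, 1) * Y ω) := by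
    ext ω
    have : ((X ω, Y ω) : ℝ × ℝ) = X ω • (1, 0) + Y ω • (0, 1) := by simp
    simp only [this, map_add, map_smul, smul_eq_mul, Pi.add_apply]
    ring
  rw [h.gaussian.charFunDual_map_eq_fun]
  have hm : ∫ ω, L (X ω, Y ω) ∂P = 0 := by
    rw [hL, integral_add' ((hX.integrable one_le_two).const_mul _)
      ((hY.integrable one_le_two).const_mul _), integral_const_mul, integral_const_mul,
      h.mean_fst, h.mean_snd]
    simp
  rw [hm, hL, variance_add (hX.const_mul _) (hY.const_mul _), variance_const_mul, variance_const_mul,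
    covariance_const_mul_left, covariance_const_mul_right, h.var_fst, h.var_snd, h.cov_eq]
  congr 1
  push_cast
  ring

theorem StdPair.map_eq (h : StdPair X Y ρ P) (h' : StdPair X' Y' ρ P') :
    (P.map fun ω => (X ω, Y ω)) = P'.map fun ω => (X' ω, Y' ω) := by
  have := h.isProbabilityMeasure
  have := h'.isProbabilityMeasure
  have := h.gaussian.aemeasurable
  have := h'.gaussian.aemeasurable
  apply Measure.ext_of_charFunDual
  ext L
  rw [h.charFunDual_eq, h'.charFunDual_eq]

end Pair

/-! ### A normal variable with prescribed correlations to independent ones. -/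

section Exchangeable

theorem covariance_eval_pi_gaussian {ι : Type*} [Fintype ι] [DecidableEq ι] (i j : ι) :
    cov[fun g : ι → ℝ => g i, fun g => g j; Measure.pi fun _ => gaussianReal 0 1]
      = if i = j then 1 else 0 := by
  have hm : ∀ i : ι, MeasurePreserving (fun g : ι → ℝ => g i)
      (Measure.pi fun _ => gaussianReal 0 1) (gaussianReal 0 1) := fun i =>
    measurePreserving_eval (fun _ : ι => gaussianReal 0 1) i
  have hL : ∀ i : ι, MemLp (fun g : ι → ℝ => g i) 2 (Measure.pi fun _ => gaussianReal 0 1) :=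
    fun i => (memLp_id_gaussianReal 2).comp_measurePreserving (hm i)
  split_ifs with h
  · subst h
    rw [covariance_self (hm i).aemeasurable]
    have := (hm i).variance_fun_comp (f := id) aemeasurable_id
    simpa using this
  · have hi : iIndepFun (fun (i : ι) (g : ι → ℝ) => g i) (Measure.pi fun _ => gaussianReal 0 1) :=
      iIndepFun_pi (X := fun _ => id) (fun _ => aemeasurable_id)
    exact (hi.indepFun h).covariance_eq_zero (hL i) (hL j)

theorem stdPair_pi {ι : Type*} [Fintype ι] [DecidableEq ι] (a : ι → ℝ) (ha : ∑ i, a i ^ 2 = 1)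
    (i : ι) :
    StdPair (fun g : ι → ℝ => ∑ k, a k * g k) (fun g => g i) (a i)
      (Measure.pi fun _ => gaussianReal 0 1) := by
  have hm : ∀ i : ι, MeasurePreserving (fun g : ι → ℝ => g i)
      (Measure.pi fun _ => gaussianReal 0 1) (gaussianReal 0 1) := fun i =>
    measurePreserving_eval (fun _ : ι => gaussianReal 0 1) i
  have hL : ∀ i : ι, MemLp (fun g : ι → ℝ => g i) 2 (Measure.pi fun _ => gaussianReal 0 1) :=
    fun i => (memLp_id_gaussianReal 2).comp_measurePreserving (hm i)
  have hi : iIndepFun (fun (i : ι) (g : ι → ℝ) => g i) (Measure.pi fun _ => gaussianReal 0 1) :=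
    iIndepFun_pi (X := fun _ => id) (fun _ => aemeasurable_id)
  have h0 : ∀ i : ι, ∫ g : ι → ℝ, g i ∂(Measure.pi fun _ => gaussianReal 0 1) = 0 := fun i => by
    have := integral_map (f := id) (hm i).aemeasurable (by fun_prop)
    rw [(hm i).map_eq] at this
    simpa using this.symm
  have hL' : ∀ k, MemLp (fun g : ι → ℝ => a k * g k) 2 (Measure.pi fun _ => gaussianReal 0 1) :=
    fun k => (hL k).const_mul _
  have hG : HasGaussianLaw (fun g : ι → ℝ => fun i => g i)
      (Measure.pi fun _ => gaussianReal 0 1) := by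
    refine hi.hasGaussianLaw fun i => ⟨?_⟩
    rw [(hm i).map_eq]
    infer_instance
  constructor
  · have := hG.map (((∑ k, a k • ContinuousLinearMap.proj (R := ℝ) (φ := fun _ : ι => ℝ) k)).prod
      (ContinuousLinearMap.proj i))
    refine this.congr (Filter.Eventually.of_forall fun g => ?_)
    simp
  · rw [integral_finsetSum _ fun k _ => (hL' k).integrable one_le_two]
    simp [integral_const_mul, h0]
  · exact h0 i
  · rw [variance_fun_sum hL']
    simp_rw [covariance_const_mul_left, covariance_const_mul_right, covariance_eval_pi_gaussian]
    simpa [pow_two] using ha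
  · rw [← covariance_self (hm i).aemeasurable, covariance_eval_pi_gaussian]
    simp
  · rw [covariance_fun_sum_left hL' (hL i)]
    simp_rw [covariance_const_mul_left, covariance_eval_pi_gaussian]
    simp

end Exchangeable

/-! ### Gebelein-type covariance inequality. -/

section Decorrelation

variable {Ω : Type*} [MeasurableSpace Ω] {X Y : Ω → ℝ} {ρ : ℝ} {P : Measure Ω}

theorem covariance_sq_le [IsProbabilityMeasure P] (hX : MemLp X 2 P) (hY : MemLp Y 2 P) :
    cov[X, Y; P] ^ 2 ≤ Var[X; P] * Var[Y; P] := by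
  have h : ∀ t : ℝ, 0 ≤ Var[Y; P] * (t * t) + (2 * cov[X, Y; P]) * t + Var[X; P] := fun t => by
    have h := variance_nonneg (X + fun ω => t * Y ω) P
    rw [variance_add hX (hY.const_mul t), variance_const_mul, covariance_const_mul_right] at h
    linarith
  have := discrim_le_zero h
  unfold discrim at this
  nlinarith

theorem memLp_comp_of_bounded [IsProbabilityMeasure P] {f : ℝ → ℝ} (hf : Measurable f) {b : ℝ}
    (hb : ∀ x, |f x| ≤ b) (hX : AEMeasurable X P) : MemLp (fun ω => f (X ω)) 2 P :=
  MemLp.of_bound (hf.comp_aemeasurable hX).aestronglyMeasurable b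
    (Filter.Eventually.of_forall fun ω => by simpa using hb (X ω))

theorem StdPair.map_fst (h : StdPair X Y ρ P) : P.map X = gaussianReal 0 1 := by
  rw [h.gaussian.fst.map_eq_gaussianReal, h.mean_fst, h.var_fst]
  simp

theorem StdPair.map_snd (h : StdPair X Y ρ P) : P.map Y = gaussianReal 0 1 := by
  rw [h.gaussian.snd.map_eq_gaussianReal, h.mean_snd, h.var_snd]
  simp

theorem StdPair.cov_comp_eq {Ω' : Type*} [MeasurableSpace Ω'] {X' Y' : Ω' → ℝ} {P' : Measure Ω'}
    (h : StdPair X Y ρ P) (h' : StdPair X' Y' ρ P') {f : ℝ → ℝ} (hf : Measurable f) :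
    cov[fun ω => f (X ω), fun ω => f (Y ω); P] = cov[fun ω => f (X' ω), fun ω => f (Y' ω); P'] := by
  have h1 : AEStronglyMeasurable (fun z : ℝ × ℝ => f z.1) (P.map fun ω => (X ω, Y ω)) :=
    (hf.comp measurable_fst).aestronglyMeasurable
  have h2 : AEStronglyMeasurable (fun z : ℝ × ℝ => f z.2) (P.map fun ω => (X ω, Y ω)) :=
    (hf.comp measurable_snd).aestronglyMeasurable
  have e1 := covariance_map_fun h1 h2 h.gaussian.aemeasurable
  rw [h.map_eq h'] at e1 h1 h2
  rw [← e1, covariance_map_fun h1 h2 h'.gaussian.aemeasurable]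

theorem StdPair.var_comp_fst (h : StdPair X Y ρ P) {f : ℝ → ℝ} (hf : Measurable f) :
    Var[fun ω => f (X ω); P] = Var[f; gaussianReal 0 1] := by
  rw [← h.map_fst, variance_map (by fun_prop) h.gaussian.fst.aemeasurable]
  rfl

theorem StdPair.var_comp_snd (h : StdPair X Y ρ P) {f : ℝ → ℝ} (hf : Measurable f) :
    Var[fun ω => f (Y ω); P] = Var[f; gaussianReal 0 1] := by
  rw [← h.map_snd, variance_map (by fun_prop) h.gaussian.snd.aemeasurable]
  rfl

/-- Compare `Y` with `n` independent standard normal variables, all having correlation `ρ` with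
one further standard normal variable, and apply the Cauchy-Schwarz inequality to their sum. -/
theorem StdPair.card_mul_cov_sq_le (h : StdPair X Y ρ P) {f : ℝ → ℝ} (hf : Measurable f) {b : ℝ}
    (hb : ∀ x, |f x| ≤ b) {n : ℕ} (hn : 0 < n) (hρ : n * ρ ^ 2 ≤ 1) :
    n * cov[fun ω => f (X ω), fun ω => f (Y ω); P] ^ 2 ≤ Var[f; gaussianReal 0 1] ^ 2 := by
  -- The coordinate `none` takes the remaining weight that makes `a` a unit vector; this is where `n
  -- ρ² ≤ 1` is needed.
  let a : Option (Fin n) → ℝ := fun o => o.elim (Real.sqrt (1 - n * ρ ^ 2)) fun _ => ρ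
  let G : Measure (Option (Fin n) → ℝ) := Measure.pi fun _ => gaussianReal 0 1
  have ha : ∑ o, a o ^ 2 = 1 := by
    simp only [a, Fintype.sum_option, Option.elim, Finset.sum_const, Finset.card_univ,
      Fintype.card_fin, nsmul_eq_mul]
    rw [Real.sq_sqrt (by linarith)]
    ring
  have hp : ∀ i : Fin n, StdPair (fun g : Option (Fin n) → ℝ => ∑ k, a k * g k)
      (fun g => g (some i)) ρ G := fun i => stdPair_pi a ha (some i)
  set F : (Option (Fin n) → ℝ) → ℝ := fun g => f (∑ k, a k * g k) with hF
  set H : Fin n → (Option (Fin n) → ℝ) → ℝ := fun i g => f (g (some i)) with hH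
  let i₀ : Fin n := ⟨0, hn⟩
  have hFm : MemLp F 2 G := memLp_comp_of_bounded hf hb (hp i₀).gaussian.fst.aemeasurable
  have hHm : ∀ i, MemLp (H i) 2 G := fun i =>
    memLp_comp_of_bounded hf hb (hp i).gaussian.snd.aemeasurable
  have hcov : cov[F, ∑ i, H i; G] = n * cov[fun ω => f (X ω), fun ω => f (Y ω); P] := by
    rw [covariance_sum_right hHm hFm,
      Finset.sum_congr rfl fun i _ => ((hp i).cov_comp_eq h hf)]
    simp
  have hind : iIndepFun H G :=
    ((iIndepFun_pi (μ := fun _ : Option (Fin n) => gaussianReal 0 1) (X := fun _ => f)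
      (fun _ => hf.aemeasurable)).precomp (Option.some_injective _))
  have hvar : Var[∑ i, H i; G] = n * Var[f; gaussianReal 0 1] := by
    rw [IndepFun.variance_sum (fun i _ => hHm i) fun i _ j _ hij => hind.indepFun hij,
      Finset.sum_congr rfl fun i _ => (hp i).var_comp_snd hf]
    simp
  -- With `c` the covariance and `v` the variance this reads `(n c)² ≤ v · (n v)`, since
  -- independence makes the variance of the sum linear in `n`.
  have hcs := covariance_sq_le hFm (memLp_finsetSum' Finset.univ fun i _ => hHm i)
  rw [hcov, hvar, (hp i₀).var_comp_fst hf] at hcs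
  have : (0 : ℝ) < n := by exact_mod_cast hn
  refine le_of_mul_le_mul_left ?_ this
  nlinarith

/-- Gebelein's inequality, up to a factor `2`. -/
theorem StdPair.abs_cov_comp_le (h : StdPair X Y ρ P) {f : ℝ → ℝ} (hf : Measurable f) {b : ℝ}
    (hb : ∀ x, |f x| ≤ b) :
    |cov[fun ω => f (X ω), fun ω => f (Y ω); P]| ≤ 2 * |ρ| * Var[f; gaussianReal 0 1] := by
  have := h.isProbabilityMeasure
  have hv : 0 ≤ Var[f; gaussianReal 0 1] := variance_nonneg _ _
  set v := Var[f; gaussianReal 0 1]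
  set c := cov[fun ω => f (X ω), fun ω => f (Y ω); P] with hc
  apply abs_le_of_sq_le_sq _ (by positivity)
  rw [mul_pow, mul_pow, sq_abs]
  have hcs : c ^ 2 ≤ v ^ 2 := by
    have := covariance_sq_le (memLp_comp_of_bounded hf hb h.gaussian.fst.aemeasurable)
      (memLp_comp_of_bounded hf hb h.gaussian.snd.aemeasurable)
    rw [h.var_comp_fst hf, h.var_comp_snd hf] at this
    rw [hc]
    nlinarith
  rcases le_or_gt 1 (ρ ^ 2) with h1 | h1
  · nlinarith [sq_nonneg v]
  -- For `ρ = 0` every `n` is allowed, forcing `c = 0`. Otherwise the largest allowed `n` is `⌊1 /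
  -- ρ²⌋`.
  rcases eq_or_ne ρ 0 with rfl | h0
  · have key : ∀ n : ℕ, n * c ^ 2 ≤ v ^ 2 := fun n => by
      rcases Nat.eq_zero_or_pos n with rfl | hn
      · simp; positivity
      · exact h.card_mul_cov_sq_le hf hb hn (by simp)
    by_contra hcon
    have hcpos : 0 < c ^ 2 := by
      have : c ≠ 0 := by simpa using hcon
      positivity
    obtain ⟨n, hn⟩ := exists_nat_gt (v ^ 2 / c ^ 2)
    rw [div_lt_iff₀ hcpos] at hn
    exact absurd (key n) (not_le.2 hn)
  · have hρ : 0 < ρ ^ 2 := by positivity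
    have hfl := Nat.floor_le (a := 1 / ρ ^ 2) (by positivity)
    have hlt := Nat.lt_floor_add_one (1 / ρ ^ 2)
    rw [le_div_iff₀ hρ] at hfl
    rw [div_lt_iff₀ hρ] at hlt
    have hpos : 0 < ⌊1 / ρ ^ 2⌋₊ := by
      rw [Nat.floor_pos, le_div_iff₀ hρ]
      linarith
    have key := h.card_mul_cov_sq_le hf hb hpos hfl
    have h1' : (1 : ℝ) ≤ ⌊1 / ρ ^ 2⌋₊ := by exact_mod_cast hpos
    set N : ℝ := (⌊1 / ρ ^ 2⌋₊ : ℝ)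
    -- From `(N + 1) ρ² > 1` and `N ≥ 1`; the factor lost to the floor is at most two.
    have h2 : 1 ≤ 2 * N * ρ ^ 2 := by nlinarith
    calc c ^ 2 ≤ (2 * N * ρ ^ 2) * c ^ 2 := le_mul_of_one_le_left (sq_nonneg c) h2
      _ = 2 * ρ ^ 2 * (N * c ^ 2) := by ring
      _ ≤ 2 * ρ ^ 2 * v ^ 2 := by gcongr
      _ ≤ 2 ^ 2 * ρ ^ 2 * v ^ 2 := by nlinarith [mul_nonneg hρ.le (sq_nonneg v)]

end Decorrelation

/-! ### Normal p-values: super-uniformity and tails. -/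

section PValue

theorem pValue_nonneg (t : ℝ) : 0 ≤ pValue t := mul_nonneg zero_le_two (cdf_nonneg _ _)

theorem pValue_anti {s t : ℝ} (h : |s| ≤ |t|) : pValue t ≤ pValue s :=
  mul_le_mul_of_nonneg_left (monotone_cdf _ (neg_le_neg h)) zero_le_two

theorem measurable_pValue : Measurable pValue :=
  ((monotone_cdf (gaussianReal 0 1)).measurable.comp
    (measurable_id.abs.neg)).const_mul 2

/-- By inner regularity it suffices to treat compact subsets. Such a set lies to the left of its
greatest point `x`, and the mass of that half-line is the cdf at `x`, at most `s`. No continuity of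
the cdf is needed. -/
theorem measure_cdf_le_le (μ : Measure ℝ) [IsProbabilityMeasure μ] (s : ℝ) :
    μ {x | cdf μ x ≤ s} ≤ ENNReal.ofReal s := by
  have hmeas : MeasurableSet {x | cdf μ x ≤ s} := (monotone_cdf μ).measurable measurableSet_Iic
  rw [hmeas.measure_eq_iSup_isCompact]
  refine iSup_le fun K => iSup_le fun hK => iSup_le fun hc => ?_
  rcases K.eq_empty_or_nonempty with rfl | hne
  · simp
  obtain ⟨x, hx, hmax⟩ := hc.exists_isGreatest hne
  calc μ K ≤ μ (Set.Iic x) := measure_mono hmax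
    _ = ENNReal.ofReal (cdf μ x) := (ofReal_cdf μ x).symm
    _ ≤ ENNReal.ofReal s := ENNReal.ofReal_le_ofReal (hK hx)

theorem measure_pValue_le_le {t : ℝ} (ht : 0 ≤ t) :
    gaussianReal 0 1 {x | pValue x ≤ t} ≤ ENNReal.ofReal t := by
  have hsub : {x | pValue x ≤ t} ⊆ {x | cdf (gaussianReal 0 1) x ≤ t / 2} ∪
      (fun x => -x) ⁻¹' {x | cdf (gaussianReal 0 1) x ≤ t / 2} := fun x hx => by
    have hx' : 2 * cdf (gaussianReal 0 1) (-|x|) ≤ t := hx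
    rcases abs_choice x with h | h
    · right
      rw [h] at hx'
      simp only [Set.mem_preimage, Set.mem_ofPred_eq]
      linarith
    · left
      rw [h, neg_neg] at hx'
      simp only [Set.mem_ofPred_eq]
      linarith
  have hmeas : MeasurableSet {x | cdf (gaussianReal 0 1) x ≤ t / 2} :=
    (monotone_cdf (gaussianReal 0 1)).measurable measurableSet_Iic
  have h1 := measure_cdf_le_le (gaussianReal 0 1) (t / 2)
  calc gaussianReal 0 1 {x | pValue x ≤ t}
      ≤ _ := measure_mono hsub
    _ ≤ _ := measure_union_le _ _
    _ ≤ ENNReal.ofReal (t / 2) + ENNReal.ofReal (t / 2) := by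
        refine add_le_add h1 ?_
        rw [← Measure.map_apply measurable_neg hmeas, gaussianReal_map_neg, neg_zero]
        exact h1
    _ = ENNReal.ofReal t := by
        rw [← ENNReal.ofReal_add (by linarith) (by linarith), add_halves]

theorem pValue_le_exp {x : ℝ} (hx : 0 ≤ x) : pValue x ≤ 2 * Real.exp (-x ^ 2 / 2) := by
  unfold pValue
  rw [cdf_eq_real, abs_of_nonneg hx]
  -- Chernoff's bound at its optimal exponent.
  have h := measure_le_le_exp_mul_mgf (X := id) (μ := gaussianReal 0 1) (t := -x) (-x)
    (by linarith) (integrable_exp_mul_gaussianReal _)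
  rw [mgf_id_gaussianReal, ← Real.exp_add] at h
  have e : -(-x) * -x + (0 * -x + ((1 : NNReal) : ℝ) * (-x) ^ 2 / 2) = -x ^ 2 / 2 := by
    push_cast
    ring
  rw [e] at h
  exact mul_le_mul_of_nonneg_left h zero_le_two

end PValue

/-! ### Second-moment and union bounds for p-value counts. -/

section Counts

variable {Ω : Type*} [MeasurableSpace Ω] {μ : Measure Ω} {m : ℕ} {ξ : Fin m → Ω → ℝ}
  {r : Fin m → Fin m → ℝ} {C : ℝ}

theorem integral_indicator_pValue_le {t : ℝ} (ht : 0 ≤ t) :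
    ∫ x, {x | pValue x ≤ t}.indicator 1 x ∂(gaussianReal 0 1) ≤ t := by
  have hs : MeasurableSet {x | pValue x ≤ t} := measurable_pValue measurableSet_Iic
  rw [integral_indicator_one hs]
  exact ENNReal.toReal_le_of_le_ofReal ht (measure_pValue_le_le ht)

/-- An indicator equals its square. The linear dependence on `t` is essential: it leaves relative
Chebyshev errors of order `1 / (m₀ t)`, small even when `t` itself tends to zero. -/
theorem variance_indicator_pValue_le {t : ℝ} (ht : 0 ≤ t) :
    Var[{x | pValue x ≤ t}.indicator (1 : ℝ → ℝ); gaussianReal 0 1] ≤ t := by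
  have hm : Measurable ({x | pValue x ≤ t}.indicator (1 : ℝ → ℝ)) :=
    measurable_one.indicator (measurable_pValue measurableSet_Iic)
  refine (variance_le_expectation_sq hm.aestronglyMeasurable).trans ?_
  refine (integral_congr_ae (Filter.Eventually.of_forall fun x => ?_)).trans_le
    (integral_indicator_pValue_le ht)
  simp only [Pi.pow_apply, Set.indicator_apply]
  split_ifs <;> simp

theorem V_eq_sum (I : Finset (Fin m)) (p : Fin m → ℝ) (t : ℝ) :
    (V I p t : ℝ) = ∑ j ∈ I, if p j ≤ t then 1 else 0 := by
  simp [V, Finset.sum_boole]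

/-- Chebyshev's inequality for the number of small p-values of a weakly dependent Gaussian
vector. -/
theorem measure_lt_V_le (hξ : ∀ j k, StdPair (ξ j) (ξ k) (r j k) μ)
    (hr : ∀ j, ∑ k, |r j k| ≤ C) (I : Finset (Fin m)) {t a : ℝ} (ht : 0 ≤ t) (ha : 0 < a) :
    μ {ω | I.card * t + a < V I (fun j => pValue (ξ j ω)) t} ≤
      ENNReal.ofReal (2 * C * I.card * t / a ^ 2) := by
  rcases I.eq_empty_or_nonempty with rfl | ⟨j₀, hj₀⟩
  · simp [V, ha.not_gt]
  have := (hξ j₀ j₀).isProbabilityMeasure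
  set f : ℝ → ℝ := {x | pValue x ≤ t}.indicator 1 with hf
  have hfm : Measurable f := measurable_one.indicator (measurable_pValue measurableSet_Iic)
  have hfb : ∀ x, |f x| ≤ 1 := fun x => by
    simp only [hf, Set.indicator_apply]
    split_ifs <;> simp
  have hL : ∀ j, MemLp (fun ω => f (ξ j ω)) 2 μ := fun j =>
    memLp_comp_of_bounded hfm hfb (hξ j j).gaussian.fst.aemeasurable
  set W : Ω → ℝ := fun ω => ∑ j ∈ I, f (ξ j ω) with hW
  have hWL : MemLp W 2 μ := memLp_finsetSum I fun j _ => hL j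
  have hVW : ∀ ω, (V I (fun j => pValue (ξ j ω)) t : ℝ) = W ω := fun ω => by
    rw [V_eq_sum]
    refine Finset.sum_congr rfl fun j _ => ?_
    simp [hf, Set.indicator_apply]
  have hmean : μ[W] ≤ I.card * t := by
    rw [hW, integral_finsetSum _ fun j _ => (hL j).integrable one_le_two]
    refine (Finset.sum_le_card_nsmul I _ t fun j _ => ?_).trans_eq (nsmul_eq_mul _ _)
    have := integral_map (hξ j j).gaussian.fst.aemeasurable
      (hfm.aestronglyMeasurable (μ := μ.map (ξ j)))
    rw [(hξ j j).map_fst] at this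
    rw [← this]
    exact integral_indicator_pValue_le ht
  have hvar : Var[W; μ] ≤ 2 * C * I.card * t := by
    rw [hW, variance_fun_sum' fun j _ => hL j]
    have hv := variance_indicator_pValue_le ht
    calc ∑ j ∈ I, ∑ k ∈ I, cov[fun ω => f (ξ j ω), fun ω => f (ξ k ω); μ]
        ≤ ∑ j ∈ I, ∑ k ∈ I, 2 * |r j k| * t := by
          refine Finset.sum_le_sum fun j _ => Finset.sum_le_sum fun k _ => ?_
          refine ((le_abs_self _).trans ((hξ j k).abs_cov_comp_le hfm hfb)).trans ?_
          gcongr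
      _ ≤ ∑ j ∈ I, 2 * C * t := by
          refine Finset.sum_le_sum fun j _ => ?_
          rw [← Finset.sum_mul, ← Finset.mul_sum]
          gcongr
          exact (Finset.sum_le_univ_sum_of_nonneg fun k => abs_nonneg _).trans (hr j)
      _ = 2 * C * I.card * t := by simp; ring
  calc μ {ω | I.card * t + a < V I (fun j => pValue (ξ j ω)) t}
      ≤ μ {ω | a ≤ |W ω - μ[W]|} := by
        refine measure_mono fun ω hω => ?_
        have h1 : I.card * t + a < V I (fun j => pValue (ξ j ω)) t := hω
        rw [hVW] at h1
        have h2 : a ≤ W ω - μ[W] := by linarith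
        exact h2.trans (le_abs_self _)
    _ ≤ ENNReal.ofReal (Var[W; μ] / a ^ 2) := meas_ge_le_variance_div_sq hWL ha
    _ ≤ _ := ENNReal.ofReal_le_ofReal (by gcongr)

theorem measure_exists_pValue_le (hξ : ∀ j k, StdPair (ξ j) (ξ k) (r j k) μ) {t : ℝ}
    (ht : 0 ≤ t) : μ {ω | ∃ j, pValue (ξ j ω) ≤ t} ≤ ENNReal.ofReal (m * t) := by
  have h : {ω | ∃ j, pValue (ξ j ω) ≤ t} = ⋃ j, {ω | pValue (ξ j ω) ≤ t} := by
    ext; simp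
  rw [h]
  refine (measure_iUnion_fintype_le μ _).trans ?_
  refine (Finset.sum_le_sum (g := fun _ => ENNReal.ofReal t) fun j _ => ?_).trans_eq ?_
  · have hs : MeasurableSet {x | pValue x ≤ t} := measurable_pValue measurableSet_Iic
    have := Measure.map_apply_of_aemeasurable (hξ j j).gaussian.fst.aemeasurable hs
    rw [(hξ j j).map_fst] at this
    exact this.symm.le.trans (measure_pValue_le_le ht)
  · rw [ENNReal.ofReal_mul (by positivity)]
    simp

end Counts

/-! ### Laws of Gaussian combinations and independence. -/

section Laws

variable {Ω : Type*} [MeasurableSpace Ω] {P : Measure Ω}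

/-- A unit combination of independent centred Gaussian vectors with a common covariance matrix has
the same law. -/
theorem hasLaw_sum_smul_multivariateGaussian {ι : Type*} [Fintype ι] [DecidableEq ι] {n : ℕ}
    {S : Matrix ι ι ℝ} (hS : S.PosSemidef) {N : Fin n → Ω → EuclideanSpace ℝ ι}
    (hind : iIndepFun N P) (hlaw : ∀ i, HasLaw (N i) (multivariateGaussian 0 S) P)
    {u : Fin n → ℝ} (hu : ∑ i, u i ^ 2 = 1) :
    HasLaw (fun ω => ∑ i, u i • N i ω) (multivariateGaussian 0 S) P := by
  have := hind.isProbabilityMeasure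
  have hN : ∀ i, AEMeasurable (N i) P := fun i => (hlaw i).aemeasurable
  have hm : AEMeasurable (fun ω => ∑ i, u i • N i ω) P := by fun_prop
  refine ⟨hm, ?_⟩
  apply Measure.ext_of_charFun
  have hind' : iIndepFun (fun i ω => u i • N i ω) P :=
    hind.comp (fun i x => u i • x) fun i => measurable_const_smul (u i)
  rw [hind'.charFun_map_fun_sum_eq_prod (by fun_prop)]
  ext t
  have h1 : ∀ i, charFun (P.map fun ω => u i • N i ω) t =
      Complex.exp (-((u i ^ 2 * (t.ofLp ⬝ᵥ S.mulVec t.ofLp) : ℝ) : ℂ) / 2) := fun i => by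
    have e : (P.map fun ω => u i • N i ω) = (P.map (N i)).map (fun x => u i • x) := by
      rw [AEMeasurable.map_map_of_aemeasurable (by fun_prop) (hN i)]
      rfl
    rw [e, charFun_map_smul, (hlaw i).map_eq, charFun_multivariateGaussian hS]
    congr 1
    simp [Matrix.mulVec_smul]
    ring
  rw [Finset.prod_apply, Finset.prod_congr rfl fun i _ => h1 i, ← Complex.exp_sum,
    charFun_multivariateGaussian hS]
  congr 1
  rw [← Finset.sum_div, Finset.sum_neg_distrib, ← Complex.ofReal_sum, ← Finset.sum_mul, hu]
  simp
  ring

/-- If the law of `Φ a B` does not depend on `a` and `B` is independent of `A`, then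
`Φ A B` is independent of `A`. -/
theorem map_prodMk_eq_prod_of_indepFun {α β γ : Type*} [MeasurableSpace α] [MeasurableSpace β]
    [MeasurableSpace γ] [IsProbabilityMeasure P] {A : Ω → α} {B : Ω → β} (hA : Measurable A)
    (hB : Measurable B) (hAB : IndepFun A B P) {Φ : α → β → γ}
    (hΦ : Measurable (Function.uncurry Φ)) {μ : Measure γ} [SFinite μ]
    {D : Set α} (hD : MeasurableSet D) (hAD : ∀ᵐ ω ∂P, A ω ∈ D)
    (hμ : ∀ a ∈ D, P.map (fun ω => Φ a (B ω)) = μ) :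
    P.map (fun ω => (A ω, Φ (A ω) (B ω))) = (P.map A).prod μ := by
  have := Measure.isProbabilityMeasure_map (μ := P) hA.aemeasurable
  have := Measure.isProbabilityMeasure_map (μ := P) hB.aemeasurable
  have hsk : ∀ᵐ a ∂(P.map A), (P.map B).map (Φ a) = μ := by
    filter_upwards [(ae_map_iff hA.aemeasurable hD).2 hAD] with a ha
    have hΦa : Measurable (Φ a) := hΦ.comp measurable_prodMk_left
    rw [Measure.map_map hΦa hB]
    exact hμ a ha
  -- Under the product law `(a, b) ↦ (a, Φ a b)` is a skew product over the identity, and almost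
  -- every fibre map sends the law of `B` to `μ`.
  have := (MeasurePreserving.id (P.map A)).skew_product hΦ hsk
  have e := (indepFun_iff_map_prod_eq_prod_map_map hA.aemeasurable hB.aemeasurable).1 hAB
  have h2 := this.map_eq
  rw [← e, Measure.map_map this.measurable (hA.prodMk hB)] at h2
  exact h2

theorem IndepFun.prodMk_left_of_prodMk_right {α β γ : Type*} [MeasurableSpace α]
    [MeasurableSpace β] [MeasurableSpace γ] [IsProbabilityMeasure P] {A : Ω → α} {B : Ω → β}
    {C : Ω → γ} (hA : Measurable A) (hB : Measurable B) (hC : Measurable C)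
    (hABC : IndepFun A (fun ω => (B ω, C ω)) P) (hBC : IndepFun B C P) :
    IndepFun (fun ω => (A ω, B ω)) C P := by
  have hAB : IndepFun A B P := hABC.comp measurable_id measurable_fst
  have := Measure.isProbabilityMeasure_map (μ := P) hA.aemeasurable
  have := Measure.isProbabilityMeasure_map (μ := P) hB.aemeasurable
  have := Measure.isProbabilityMeasure_map (μ := P) hC.aemeasurable
  rw [indepFun_iff_map_prod_eq_prod_map_map (by fun_prop) (by fun_prop)] at *
  rw [hBC] at hABC
  rw [hAB, ← (measurePreserving_prodAssoc _ _ _).symm.map_eq, ← hABC, Measure.map_map (by fun_prop) (by fun_prop)]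
  rfl

end Laws

/-! ### The data-driven threshold. -/

section Threshold

variable {m : ℕ} {τ ν : ℝ} {p : Fin m → ℝ}

theorem R_mono {s t : ℝ} (h : s ≤ t) : R p s ≤ R p t :=
  Finset.card_le_card fun j hj => by
    simp only [Finset.mem_filter, Finset.mem_univ, true_and] at hj ⊢
    exact hj.trans h

theorem V_mono {I : Finset (Fin m)} {s t : ℝ} (h : s ≤ t) : V I p s ≤ V I p t :=
  Finset.card_le_card fun j hj => by
    simp only [Finset.mem_filter] at hj ⊢
    exact ⟨hj.1, hj.2.trans h⟩

theorem R_le_card (t : ℝ) : R p t ≤ m :=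
  (Finset.card_filter_le _ _).trans_eq (Finset.card_fin m)

theorem V_add_S (I : Finset (Fin m)) (t : ℝ) : V I p t + S I p t = R p t := by
  unfold V S R
  rw [← Finset.card_union_of_disjoint
    (Finset.disjoint_filter_filter disjoint_compl_right), ← Finset.filter_union,
    Finset.union_compl]

theorem nullPropEst_mul (ν : ℝ) (p : Fin m → ℝ) :
    nullPropEst ν p * m = (m - R p ν) / (1 - ν) := by
  rcases Nat.eq_zero_or_pos m with rfl | hm
  · have := R_le_card (p := p) ν
    simp at this
    simp [this]
  · have : (m : ℝ) ≠ 0 := by positivity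
    unfold nullPropEst
    rw [mul_comm (1 - ν), ← div_div, div_mul_eq_mul_div, div_mul_cancel₀ _ this]

theorem nullPropEst_mul_nonneg (hν : ν < 1) : 0 ≤ nullPropEst ν p * m := by
  rw [nullPropEst_mul]
  have : (R p ν : ℝ) ≤ m := by exact_mod_cast R_le_card ν
  exact div_nonneg (by linarith) (by linarith)

theorem FDRest_le_iff {t : ℝ} :
    FDRest ν p t ≤ τ ↔ nullPropEst ν p * m * t ≤ τ * max (R p t : ℝ) 1 :=
  div_le_iff₀ (by positivity)

theorem bddAbove_FDRest_le :
    BddAbove {t : ℝ | t ∈ Set.Ioc (0 : ℝ) 1 ∧ FDRest ν p t ≤ τ} :=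
  ⟨1, fun _ ht => ht.1.2⟩

theorem le_tStar {t : ℝ} (ht : t ∈ Set.Ioc (0 : ℝ) 1) (h : FDRest ν p t ≤ τ) :
    t ≤ tStar τ ν p :=
  le_csSup bddAbove_FDRest_le ⟨ht, h⟩

theorem nonempty_FDRest_le (hτ : 0 < τ) (hν : ν < 1) :
    {t : ℝ | t ∈ Set.Ioc (0 : ℝ) 1 ∧ FDRest ν p t ≤ τ}.Nonempty := by
  have ha := nullPropEst_mul_nonneg (p := p) hν
  -- So small that the estimate is at most `τ` even without rejections; the `+ 1` keeps the
  -- denominator positive.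
  refine ⟨min 1 (τ / (nullPropEst ν p * m + 1)), ⟨by positivity, min_le_left _ _⟩, ?_⟩
  rw [FDRest_le_iff]
  set a := nullPropEst ν p * m
  calc a * min 1 (τ / (a + 1)) ≤ a * (τ / (a + 1)) := by gcongr; exact min_le_right _ _
    _ = τ * (a / (a + 1)) := by ring
    _ ≤ τ * 1 := by gcongr; exact div_le_one_of_le₀ (by linarith) (by linarith)
    _ ≤ _ := by gcongr; exact le_max_right _ _

theorem tStar_mem_Ioc (hτ : 0 < τ) (hν : ν < 1) : tStar τ ν p ∈ Set.Ioc (0 : ℝ) 1 := by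
  obtain ⟨t, ht⟩ := nonempty_FDRest_le (p := p) hτ hν
  exact ⟨ht.1.1.trans_le (le_tStar ht.1 ht.2), csSup_le ⟨t, ht⟩ fun _ hs => hs.1.2⟩

/-- The supremum is attained: with `a = π̂₀ m`, each admissible `t` satisfies `a t ≤ τ max (R t) 1 ≤
τ max (R t*) 1` by monotonicity of `R`, and the left side may be taken to the supremum. -/
theorem FDRest_tStar_le (hτ : 0 < τ) (hν : ν < 1) : FDRest ν p (tStar τ ν p) ≤ τ := by
  have ha := nullPropEst_mul_nonneg (p := p) hν
  rw [FDRest_le_iff]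
  rcases ha.eq_or_lt with h0 | hpos
  · rw [← h0, zero_mul]
    positivity
  rw [mul_comm, ← le_div_iff₀ hpos]
  refine csSup_le (nonempty_FDRest_le hτ hν) fun t ht => ?_
  have h1 := FDRest_le_iff.1 ht.2
  rw [le_div_iff₀ hpos, mul_comm]
  refine h1.trans ?_
  have : (R p t : ℝ) ≤ R p (tStar τ ν p) := by exact_mod_cast R_mono (le_tStar ht.1 ht.2)
  gcongr

/-- The largest `t ≤ 1` with `a t ≤ τ max {k, 1}`. -/
noncomputable def cutoff (τ a : ℝ) (k : ℕ) : ℝ :=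
  if a ≤ τ * max (k : ℝ) 1 then 1 else τ * max (k : ℝ) 1 / a

/-- Replaces the uncountable supremum by a countable union, which makes `t*` measurable. Forwards
`k` is the number of rejections at `t*`; backwards the cutoff itself is an admissible threshold. -/
theorem le_tStar_iff (hτ : 0 < τ) (hν : ν < 1) {s : ℝ} (hs : 0 < s) :
    s ≤ tStar τ ν p ↔ ∃ k : ℕ, s ≤ cutoff τ (nullPropEst ν p * m) k ∧
      (k : ℝ) ≤ R p (cutoff τ (nullPropEst ν p * m) k) := by
  have ha := nullPropEst_mul_nonneg (p := p) hν
  constructor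
  · intro h
    have ht := tStar_mem_Ioc (p := p) hτ hν
    have hle : tStar τ ν p ≤
        cutoff τ (nullPropEst ν p * m) (R p (tStar τ ν p)) := by
      have h1 := FDRest_le_iff.1 (FDRest_tStar_le (p := p) hτ hν)
      unfold cutoff
      split_ifs with hc
      · exact ht.2
      · have hpos : 0 < nullPropEst ν p * m :=
          lt_of_le_of_lt (by positivity) (not_le.1 hc)
        rw [le_div_iff₀ hpos, mul_comm]
        exact h1
    exact ⟨R p (tStar τ ν p), h.trans hle, by exact_mod_cast R_mono hle⟩
  · rintro ⟨k, hk, hR⟩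
    refine hk.trans (le_tStar ⟨hs.trans_le hk, ?_⟩ ?_)
    · unfold cutoff
      split_ifs with hc
      · exact le_rfl
      · exact div_le_one_of_le₀ (not_le.1 hc).le ha
    · rw [FDRest_le_iff]
      have h2 : τ * max (k : ℝ) 1 ≤
          τ * max (R p (cutoff τ (nullPropEst ν p * m) k) : ℝ) 1 := by gcongr
      refine le_trans ?_ h2
      unfold cutoff
      split_ifs with hc
      · simpa using hc
      · have hpos : 0 < nullPropEst ν p * m :=
          lt_of_le_of_lt (by positivity) (not_le.1 hc)
        rw [mul_div_cancel₀ _ hpos.ne']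

end Threshold

/-! ### Measurability of counts and threshold. -/

section Measurability

variable {Ω : Type*} [MeasurableSpace Ω] {m : ℕ} {τ ν : ℝ} {p : Ω → Fin m → ℝ}
  {I : Ω → Finset (Fin m)} {T : Ω → ℝ}

theorem measurable_V (hI : ∀ j, MeasurableSet {ω | j ∈ I ω}) (hp : Measurable p)
    (hT : Measurable T) : Measurable fun ω => (V (I ω) (p ω) (T ω) : ℝ) := by
  have h : (fun ω => (V (I ω) (p ω) (T ω) : ℝ)) =
      fun ω => ∑ j, ({ω | j ∈ I ω} ∩ {ω | p ω j ≤ T ω}).indicator 1 ω := by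
    ext ω
    rw [V_eq_sum, ← Finset.sum_filter_add_sum_filter_not Finset.univ (fun j => j ∈ I ω),
      Finset.sum_eq_zero (s := Finset.univ.filter fun j => j ∉ I ω), add_zero]
    · refine Finset.sum_congr (by ext; simp) fun j hj => ?_
      have hj' : j ∈ I ω := by simpa using hj
      simp [Set.indicator_apply, hj']
    · intro j hj
      simp only [Finset.mem_filter] at hj
      simp [hj.2]
  rw [h]
  refine Finset.measurable_sum _ fun j _ => measurable_one.indicator ((hI j).inter ?_)
  exact measurableSet_le ((measurable_pi_apply j).comp hp) hT

theorem measurable_S (hI : ∀ j, MeasurableSet {ω | j ∈ I ω}) (hp : Measurable p)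
    (hT : Measurable T) : Measurable fun ω => (S (I ω) (p ω) (T ω) : ℝ) :=
  measurable_V (I := fun ω => (I ω)ᶜ)
    (fun j => by
      simp only [Finset.mem_compl]
      exact (hI j).compl) hp hT

theorem measurable_R (hp : Measurable p) (hT : Measurable T) :
    Measurable fun ω => (R (p ω) (T ω) : ℝ) :=
  measurable_V (I := fun _ => Finset.univ) (by simp) hp hT

theorem measurable_tStar (hτ : 0 < τ) (hν : ν < 1) (hp : Measurable p) :
    Measurable fun ω => tStar τ ν (p ω) := by
  have ha : Measurable fun ω => nullPropEst ν (p ω) * m := by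
    simp_rw [nullPropEst_mul]
    exact (measurable_const.sub (measurable_R hp measurable_const)).div_const _
  have hc : ∀ k, Measurable fun ω => cutoff τ (nullPropEst ν (p ω) * m) k := fun k =>
    Measurable.ite (ha measurableSet_Iic) measurable_const (measurable_const.div ha)
  refine measurable_of_Ici fun s => ?_
  rcases le_or_gt s 0 with hs | hs
  · convert MeasurableSet.univ
    ext ω
    simpa using hs.trans (tStar_mem_Ioc hτ hν).1.le
  · have : (fun ω => tStar τ ν (p ω)) ⁻¹' Set.Ici s =
        ⋃ k : ℕ, {ω | s ≤ cutoff τ (nullPropEst ν (p ω) * m) k} ∩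
          {ω | (k : ℝ) ≤ R (p ω) (cutoff τ (nullPropEst ν (p ω) * m) k)} := by
      ext ω
      simp only [Set.mem_preimage, Set.mem_Ici, Set.mem_iUnion]
      exact le_tStar_iff hτ hν hs
    rw [this]
    exact MeasurableSet.iUnion fun k => (measurableSet_le measurable_const (hc k)).inter
      (measurableSet_le measurable_const (measurable_R hp (hc k)))

end Measurability

/-! ### The projection `Q(X)` under the eigenvalue bound. -/

section Design

variable {p n : ℕ} {X : Matrix (Fin n) (Fin p) ℝ} {b : ℝ}

/-- The shifted matrix `A - b` has nonnegative spectrum, hence is positive semidefinite. -/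
theorem dotProduct_mulVec_of_le_spectrum {ι : Type*} [Fintype ι] [DecidableEq ι]
    {A : Matrix ι ι ℝ} (hA : A.IsHermitian) (hb : ∀ l ∈ spectrum ℝ A, b ≤ l) (v : ι → ℝ) :
    b * (v ⬝ᵥ v) ≤ v ⬝ᵥ A.mulVec v := by
  have hp : (algebraMap ℝ (Matrix ι ι ℝ) (-b) + A).PosSemidef := by
    rw [Matrix.posSemidef_iff_isHermitian_and_spectrum_nonneg]
    constructor
    · refine Matrix.IsHermitian.add ?_ hA
      rw [Matrix.algebraMap_eq_diagonal]
      exact Matrix.isHermitian_diagonal _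
    · intro l hl
      have : l + b ∈ spectrum ℝ A := by
        rw [spectrum.add_mem_iff]
        simpa using hl
      have := hb _ this
      simp only [Set.mem_ofPred_eq]
      linarith
  have := hp.dotProduct_mulVec_nonneg v
  rw [Matrix.add_mulVec, dotProduct_add] at this
  simp [Algebra.algebraMap_eq_smul_one, Matrix.neg_mulVec, Matrix.smul_mulVec] at this
  linarith

/-- A lower bound for the eigenvalues of `(1, X)' (1, X) / n`. -/
def DesignBound (b : ℝ) (X : Matrix (Fin n) (Fin p) ℝ) : Prop :=
  ∀ l ∈ spectrum ℝ ((n : ℝ)⁻¹ • ((Matrix.fromCols (onesCol (Fin n)) X).transpose *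
    Matrix.fromCols (onesCol (Fin n)) X)), b ≤ l

/-- For `n = 0` the Gram matrix is zero, and its index type contains `Unit`, so zero would be an
eigenvalue. -/
theorem DesignBound.pos (h : DesignBound b X) (hb : 0 < b) : 0 < n := by
  rcases Nat.eq_zero_or_pos n with rfl | hn
  · exfalso
    have := h 0 (by simp [spectrum.zero_eq])
    linarith
  · exact hn

/-- The Rayleigh bound at the vector `(s, v)`. The case `s = 0` makes `X'X` invertible; the case `s
= 1` bounds `c_n²` below, because `Q(X) 1` is `1` plus a vector in the column space of `X`. -/
theorem DesignBound.mul_dotProduct_le (h : DesignBound b X) (hb : 0 < b) (s : ℝ)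
    (v : Fin p → ℝ) :
    n * b * (s ^ 2 + v ⬝ᵥ v) ≤ ((fun _ => s) + X.mulVec v) ⬝ᵥ ((fun _ => s) + X.mulVec v) := by
  have hn : (0 : ℝ) < n := by exact_mod_cast h.pos hb
  set Xt := Matrix.fromCols (onesCol (Fin n)) X with hXt
  have hH : ((n : ℝ)⁻¹ • (Xt.transpose * Xt)).IsHermitian := by
    rw [Matrix.IsHermitian, Matrix.conjTranspose_smul, Matrix.conjTranspose_mul]
    simp [Matrix.conjTranspose_eq_transpose_of_trivial]
  have key := dotProduct_mulVec_of_le_spectrum hH h (Sum.elim (fun _ => s) v)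
  have e : Xt.mulVec (Sum.elim (fun _ => s) v) = (fun _ => s) + X.mulVec v := by
    rw [hXt, Matrix.fromCols_mulVec_sumElim]
    congr 1
    ext i
    simp [onesCol, Matrix.mulVec, dotProduct]
  rw [Matrix.smul_mulVec, dotProduct_smul, ← Matrix.mulVec_mulVec, Matrix.dotProduct_mulVec,
    Matrix.vecMul_transpose, e, smul_eq_mul, ← div_eq_inv_mul, le_div_iff₀ hn] at key
  refine le_trans (le_of_eq ?_) key
  simp [dotProduct, Fintype.sum_sum_type, pow_two]
  ring

theorem DesignBound.isUnit_det (h : DesignBound b X) (hb : 0 < b) :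
    IsUnit (X.transpose * X).det := by
  have hn : (0 : ℝ) < n := by exact_mod_cast h.pos hb
  rw [isUnit_iff_ne_zero]
  intro h0
  obtain ⟨v, hv, hv0⟩ := Matrix.exists_mulVec_eq_zero_iff.2 h0
  have h1 := h.mul_dotProduct_le hb 0 v
  have h2 : X.mulVec v ⬝ᵥ X.mulVec v = 0 := by
    have : v ⬝ᵥ (X.transpose * X).mulVec v = 0 := by rw [hv0, dotProduct_zero]
    rwa [← Matrix.mulVec_mulVec, Matrix.dotProduct_mulVec, Matrix.vecMul_transpose] at this
  have h3 : (fun _ : Fin n => (0 : ℝ)) + X.mulVec v = X.mulVec v := by ext; simp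
  have h4 : 0 < v ⬝ᵥ v := by
    have : 0 ≤ v ⬝ᵥ v := Finset.sum_nonneg fun i _ => mul_self_nonneg _
    exact lt_of_le_of_ne this fun h => hv (dotProduct_self_eq_zero.1 h.symm)
  rw [h3, h2] at h1
  have : 0 < n * b * (0 ^ 2 + v ⬝ᵥ v) := by positivity
  linarith

theorem DesignBound.transpose_mulVec_Q (h : DesignBound b X) (hb : 0 < b) (w : Fin n → ℝ) :
    X.transpose.mulVec ((Q X).mulVec w) = 0 := by
  have : X.transpose * Q X = 0 := by
    rw [Q, Matrix.mul_sub, Matrix.mul_one, Matrix.mul_assoc X, ← Matrix.mul_assoc X.transpose,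
      ← Matrix.mul_assoc, Matrix.mul_nonsing_inv _ (h.isUnit_det hb), Matrix.one_mul, sub_self]
  rw [Matrix.mulVec_mulVec, this, Matrix.zero_mulVec]

theorem Q_mulVec_eq (X : Matrix (Fin n) (Fin p) ℝ) (w : Fin n → ℝ) :
    (Q X).mulVec w =
      w + X.mulVec (-((X.transpose * X)⁻¹.mulVec (X.transpose.mulVec w))) := by
  rw [Q, Matrix.sub_mulVec, Matrix.one_mulVec, Matrix.mulVec_neg, Matrix.mulVec_mulVec,
    Matrix.mulVec_mulVec, sub_eq_add_neg, Matrix.mul_assoc]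

theorem DesignBound.dotProduct_Q (h : DesignBound b X) (hb : 0 < b) (w : Fin n → ℝ) :
    w ⬝ᵥ (Q X).mulVec w = (Q X).mulVec w ⬝ᵥ (Q X).mulVec w := by
  conv_rhs => rw [Q_mulVec_eq X w, add_dotProduct]
  rw [← Q_mulVec_eq X w, dotProduct_comm (X.mulVec _),
    Matrix.dotProduct_mulVec ((Q X).mulVec w) X, ← Matrix.mulVec_transpose, h.transpose_mulVec_Q hb, zero_dotProduct, add_zero]

theorem DesignBound.le_dotProduct_Q (h : DesignBound b X) (hb : 0 < b) :
    n * b ≤ (fun _ => (1 : ℝ)) ⬝ᵥ (Q X).mulVec (fun _ => 1) := by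
  rw [h.dotProduct_Q hb, Q_mulVec_eq]
  refine le_trans ?_ (h.mul_dotProduct_le hb 1 _)
  have hn : (0 : ℝ) < n := by exact_mod_cast h.pos hb
  refine le_mul_of_one_le_right (by positivity) ?_
  have hnn : ∀ v : Fin p → ℝ, 0 ≤ v ⬝ᵥ v := fun v =>
    Finset.sum_nonneg fun i _ => mul_self_nonneg (v i)
  have := hnn (-((X.transpose * X)⁻¹.mulVec (X.transpose.mulVec fun _ => 1)))
  linarith

end Design

/-! ### Normalized coordinates of a Gaussian vector. -/

section Gaussian

/-- The normalized coordinates of a Gaussian vector. -/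
theorem stdPair_multivariateGaussian {ι : Type*} [Fintype ι] [DecidableEq ι] {S : Matrix ι ι ℝ}
    (hS : S.PosSemidef) {i j : ι} (hi : 0 < S i i) (hj : 0 < S j j) :
    StdPair (fun g : EuclideanSpace ℝ ι => g i / Real.sqrt (S i i))
      (fun g => g j / Real.sqrt (S j j)) (S i j / (Real.sqrt (S i i) * Real.sqrt (S j j)))
      (multivariateGaussian 0 S) := by
  have hmean : ∀ k : ι, ∫ g : EuclideanSpace ℝ ι, g k / Real.sqrt (S k k)
      ∂(multivariateGaussian 0 S) = 0 := fun k => by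
    have hm := measurePreserving_eval_multivariateGaussian (μ := 0) hS (i := k)
    have := integral_map (f := id) hm.aemeasurable (by fun_prop)
    rw [hm.map_eq] at this
    simp only [id_eq, integral_id_gaussianReal] at this
    rw [integral_div, ← this]
    simp
  have hcov : ∀ k l : ι, cov[fun g : EuclideanSpace ℝ ι => g k / Real.sqrt (S k k),
      fun g => g l / Real.sqrt (S l l); multivariateGaussian 0 S] =
        S k l / (Real.sqrt (S k k) * Real.sqrt (S l l)) := fun k l => by
    rw [covariance_fun_div_left, covariance_fun_div_right,
      covariance_eval_multivariateGaussian hS, div_div, mul_comm]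
  have hvar : ∀ k : ι, 0 < S k k → Var[fun g : EuclideanSpace ℝ ι => g k / Real.sqrt (S k k);
      multivariateGaussian 0 S] = 1 := fun k hk => by
    have hm : Measurable fun g : EuclideanSpace ℝ ι => g k / Real.sqrt (S k k) := by fun_prop
    rw [← covariance_self hm.aemeasurable, hcov, Real.mul_self_sqrt hk.le, div_self hk.ne']
  refine ⟨?_, hmean i, hmean j, hvar i hi, hvar j hj, hcov i j⟩
  have := (IsGaussian.hasGaussianLaw_id (μ := multivariateGaussian 0 S)).map
    (((Real.sqrt (S i i))⁻¹ • (EuclideanSpace.proj i : EuclideanSpace ℝ ι →L[ℝ] ℝ)).prod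
      ((Real.sqrt (S j j))⁻¹ • (EuclideanSpace.proj j : EuclideanSpace ℝ ι →L[ℝ] ℝ)))
  refine this.congr (Filter.Eventually.of_forall fun g => ?_)
  simp [div_eq_inv_mul]

end Gaussian

/-! ### Deterministic consequences for FDP and power. -/

section Deterministic

variable {m : ℕ} {τ ν δ : ℝ} {p : Fin m → ℝ} {I : Finset (Fin m)}

theorem card_add_card_compl (I : Finset (Fin m)) : (I.card : ℝ) + Iᶜ.card = m := by
  have := Finset.card_add_card_compl I
  rw [Fintype.card_fin] at this
  exact_mod_cast this

theorem S_eq_card_compl {t : ℝ} (h : ∀ j ∉ I, p j ≤ t) : S I p t = Iᶜ.card := by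
  unfold S
  rw [Finset.filter_true_of_mem]
  intro j hj
  exact h j (Finset.mem_compl.1 hj)

theorem S_le_card_compl (t : ℝ) : S I p t ≤ Iᶜ.card := Finset.card_filter_le _ _

/-- If the alternatives have p-values at most `t`, then `t` is below the threshold as soon as
`m t ≤ τ (1 - ν) m₁`. -/
theorem le_tStar_of_forall_le (hτ : 0 < τ) (hν : ν < 1) {t : ℝ} (ht : t ∈ Set.Ioc (0 : ℝ) 1)
    (h : ∀ j ∉ I, p j ≤ t) (hmt : m * t ≤ τ * (1 - ν) * Iᶜ.card) : t ≤ tStar τ ν p := by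
  refine le_tStar ht (FDRest_le_iff.2 ?_)
  have hν' : 0 < 1 - ν := by linarith
  have hR : (Iᶜ.card : ℝ) ≤ R p t := by
    rw [← V_add_S I, S_eq_card_compl h]
    exact_mod_cast Nat.le_add_left _ _
  rw [nullPropEst_mul, div_mul_eq_mul_div, div_le_iff₀ hν']
  have h0 : (0 : ℝ) ≤ R p ν := Nat.cast_nonneg _
  calc ((m : ℝ) - R p ν) * t ≤ m * t := by
        have := ht.1
        gcongr
        linarith
    _ ≤ τ * (1 - ν) * Iᶜ.card := hmt
    _ ≤ τ * (1 - ν) * max (R p t : ℝ) 1 := by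
        gcongr
        exact hR.trans (le_max_left _ _)
    _ = _ := by ring

theorem POW_le_one (t : ℝ) : POW I p t ≤ 1 := by
  refine div_le_one_of_le₀ ?_ (by positivity)
  have : (S I p t : ℝ) ≤ Iᶜ.card := by exact_mod_cast S_le_card_compl t
  exact this.trans (le_max_left _ _)

theorem POW_nonneg (t : ℝ) : 0 ≤ POW I p t := by unfold POW; positivity

theorem FDP_nonneg (t : ℝ) : 0 ≤ FDP I p t := by unfold FDP; positivity

theorem FDP_le_one (t : ℝ) : FDP I p t ≤ 1 := by
  refine div_le_one_of_le₀ ?_ (by positivity)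
  have : (V I p t : ℝ) ≤ R p t := by
    rw [← V_add_S I]
    exact_mod_cast Nat.le_add_right _ _
  exact this.trans (le_max_left _ _)

theorem POW_tStar_eq_one {t : ℝ} (h : ∀ j ∉ I, p j ≤ t) (ht : t ≤ tStar τ ν p)
    (hI : 0 < Iᶜ.card) : POW I p (tStar τ ν p) = 1 := by
  have h1 : (1 : ℝ) ≤ Iᶜ.card := by exact_mod_cast hI
  unfold POW
  rw [S_eq_card_compl fun j hj => (h j hj).trans ht, max_eq_left h1, div_self (by positivity)]

theorem V_congr {p' : Fin m → ℝ} (h : ∀ j ∈ I, p j = p' j) (t : ℝ) : V I p t = V I p' t := by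
  unfold V
  congr 1
  exact Finset.filter_congr fun j hj => by rw [h j hj]

/-- The vector of p-values `p` is regular for the set `I` of nulls if the number of small null
p-values is well controlled along the geometric grid `(1 + δ) ^ k * s` and at `ν`. -/
def Regular (ν δ s : ℝ) (I : Finset (Fin m)) (p : Fin m → ℝ) : Prop :=
  (∀ k : ℕ, (V I p ((1 + δ) ^ k * s) : ℝ) ≤
    I.card * ((1 + δ) ^ k * s) + δ * (I.card * ((1 + δ) ^ k * s))) ∧
  (V I p ν : ℝ) ≤ I.card * ν + δ * (1 - ν) * I.card

/-- Round `t` up to the next grid point: one factor `1 + δ` pays for the rounding, the other for the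
deviation allowed there. -/
theorem Regular.V_le {s t : ℝ} (h : Regular ν δ s I p) (hδ : 0 < δ) (hs : 0 < s) (hst : s ≤ t) :
    (V I p t : ℝ) ≤ (1 + δ) ^ 2 * (I.card * t) := by
  obtain ⟨k, hk1, hk2⟩ := exists_nat_pow_near (x := t / s) (y := 1 + δ)
    ((one_le_div hs).2 hst) (by linarith)
  rw [le_div_iff₀ hs] at hk1
  rw [div_lt_iff₀ hs] at hk2
  calc (V I p t : ℝ) ≤ V I p ((1 + δ) ^ (k + 1) * s) := by exact_mod_cast V_mono hk2.le
    _ ≤ _ := h.1 (k + 1)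
    _ = (1 + δ) ^ 2 * (I.card * ((1 + δ) ^ k * s)) := by ring
    _ ≤ _ := by gcongr

theorem Regular.FDP_tStar_le {s : ℝ} (h : Regular ν δ s I p) (hτ : 0 < τ) (hν : ν < 1)
    (hδ : 0 < δ) (hδ1 : δ < 1) (hs : 0 < s) (hst : s ≤ tStar τ ν p) :
    FDP I p (tStar τ ν p) ≤ (1 + δ) ^ 2 / (1 - δ) * τ := by
  have hT := tStar_mem_Ioc (p := p) hτ hν
  have hF := FDRest_le_iff.1 (FDRest_tStar_le (p := p) hτ hν)
  have hV := h.V_le hδ hs hst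
  set T := tStar τ ν p
  have hν' : 0 < 1 - ν := by linarith
  have hδ' : 0 < 1 - δ := by linarith
  unfold FDP
  rw [div_le_iff₀ (by positivity)]
  -- Since `S(ν) ≤ m₁`, one has `m - R(ν) ≥ m₀ - V(ν) ≥ (1 - δ) (1 - ν) m₀`; the deviation at `ν`
  -- was scaled by `1 - ν` for this purpose.
  have ha : (1 - δ) * I.card ≤ nullPropEst ν p * m := by
    rw [nullPropEst_mul, le_div_iff₀ hν']
    have h1 : (R p ν : ℝ) = V I p ν + S I p ν := by exact_mod_cast (V_add_S I ν).symm
    have h2 : (S I p ν : ℝ) ≤ Iᶜ.card := by exact_mod_cast S_le_card_compl ν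
    have h3 := card_add_card_compl I
    have h4 := h.2
    nlinarith
  calc (V I p T : ℝ) ≤ (1 + δ) ^ 2 * (I.card * T) := hV
    _ = (1 + δ) ^ 2 / (1 - δ) * ((1 - δ) * I.card * T) := by field_simp
    _ ≤ (1 + δ) ^ 2 / (1 - δ) * (nullPropEst ν p * m * T) := by
        have := hT.1
        gcongr
    _ ≤ (1 + δ) ^ 2 / (1 - δ) * (τ * max (R p T : ℝ) 1) := by gcongr
    _ = _ := by ring

end Deterministic

/-! ### Probability of irregular p-values. -/

section Irregular

variable {Ω : Type*} [MeasurableSpace Ω] {μ : Measure Ω} {m : ℕ} {ξ : Fin m → Ω → ℝ}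
  {r : Fin m → Fin m → ℝ} {C ν δ : ℝ} {I : Finset (Fin m)}

/-- Chebyshev at the `k`-th grid point costs `2 C / (δ² m₀ s) · (1 + δ)⁻ᵏ`, so a union bound over
the whole infinite grid converges; the summation contributes the factor `(1 + δ) / δ`. -/
theorem measure_not_regular_le (hξ : ∀ j k, StdPair (ξ j) (ξ k) (r j k) μ)
    (hr : ∀ j, ∑ k, |r j k| ≤ C) (hC : 0 ≤ C) (hI : 0 < I.card) (hν : ν ∈ Set.Ico (0 : ℝ) 1)
    (hδ : 0 < δ) {s : ℝ} (hs : 0 < s) :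
    μ {ω | ¬ Regular ν δ s I fun j => pValue (ξ j ω)} ≤
      ENNReal.ofReal (2 * C * (1 + δ) / (δ ^ 3 * (I.card * s)) +
        2 * C / (δ ^ 2 * (1 - ν) ^ 2 * I.card)) := by
  have hI' : (0 : ℝ) < I.card := by exact_mod_cast hI
  have hν' : 0 < 1 - ν := by linarith [hν.2]
  set A : ℕ → Set Ω := fun k => {ω | I.card * ((1 + δ) ^ k * s) +
    δ * (I.card * ((1 + δ) ^ k * s)) < V I (fun j => pValue (ξ j ω)) ((1 + δ) ^ k * s)}
  set B : Set Ω := {ω | I.card * ν + δ * (1 - ν) * I.card < V I (fun j => pValue (ξ j ω)) ν}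
  have hsub : {ω | ¬ Regular ν δ s I fun j => pValue (ξ j ω)} ⊆ (⋃ k, A k) ∪ B := fun ω hω => by
    have hω' : ¬ Regular ν δ s I fun j => pValue (ξ j ω) := hω
    rw [Regular, not_and_or, not_forall] at hω'
    rcases hω' with ⟨k, hk⟩ | h
    · exact Or.inl (Set.mem_iUnion.2 ⟨k, not_le.1 hk⟩)
    · exact Or.inr (not_le.1 h)
  have hA : ∀ k, μ (A k) ≤
      ENNReal.ofReal (2 * C / (δ ^ 2 * (I.card * s)) * ((1 + δ)⁻¹) ^ k) := fun k => by
    refine (measure_lt_V_le hξ hr I (by positivity) (by positivity)).trans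
      (ENNReal.ofReal_le_ofReal (le_of_eq ?_))
    rw [inv_pow]
    field_simp
  have hB : μ B ≤ ENNReal.ofReal (2 * C / (δ ^ 2 * (1 - ν) ^ 2 * I.card)) := by
    refine (measure_lt_V_le hξ hr I hν.1 (by positivity)).trans
      (ENNReal.ofReal_le_ofReal ?_)
    calc 2 * C * I.card * ν / (δ * (1 - ν) * I.card) ^ 2
        ≤ 2 * C * I.card * 1 / (δ * (1 - ν) * I.card) ^ 2 := by
          have := hν.2.le
          gcongr
      _ = _ := by field_simp
  have hq : (1 + δ)⁻¹ < 1 := inv_lt_one_of_one_lt₀ (by linarith)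
  have hsum := (summable_geometric_of_lt_one (by positivity) hq).mul_left
    (2 * C / (δ ^ 2 * (I.card * s)))
  calc μ {ω | ¬ Regular ν δ s I fun j => pValue (ξ j ω)}
      ≤ μ (⋃ k, A k) + μ B := (measure_mono hsub).trans (measure_union_le _ _)
    _ ≤ (∑' k, ENNReal.ofReal (2 * C / (δ ^ 2 * (I.card * s)) * ((1 + δ)⁻¹) ^ k)) +
          ENNReal.ofReal (2 * C / (δ ^ 2 * (1 - ν) ^ 2 * I.card)) :=
        add_le_add ((measure_iUnion_le _).trans (ENNReal.tsum_le_tsum hA)) hB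
    _ = _ := by
        rw [← ENNReal.ofReal_tsum_of_nonneg (fun k => by positivity) hsum, tsum_mul_left,
          tsum_geometric_of_lt_one (by positivity) hq, ← ENNReal.ofReal_add _ (by positivity)]
        · congr 2
          have : 1 - (1 + δ)⁻¹ = δ / (1 + δ) := by field_simp; ring
          rw [this]
          field_simp
        · have : 0 < 1 - (1 + δ)⁻¹ := by linarith
          positivity

/-- The smallest relevant value of the threshold. -/
noncomputable def gridStart (τ ν : ℝ) (I : Finset (Fin m)) : ℝ :=
  min (τ * (1 - ν) * Iᶜ.card / m) 1

theorem gridStart_mul_card {τ : ℝ} (hτ : 0 < τ) (hν : ν < 1) {R : ℝ} (hR : 0 < R)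
    (h0 : R ≤ I.card) (h1 : R ≤ Iᶜ.card) :
    0 < gridStart τ ν I ∧ min (τ * (1 - ν) / 2) 1 * R ≤ I.card * gridStart τ ν I := by
  have hm := card_add_card_compl I
  have hν' : 0 < 1 - ν := by linarith
  have hI : (0 : ℝ) < I.card := hR.trans_le h0
  have hI1 : (0 : ℝ) < Iᶜ.card := hR.trans_le h1
  have hmp : (0 : ℝ) < m := by linarith
  refine ⟨lt_min (by positivity) one_pos, ?_⟩
  unfold gridStart
  rw [mul_min_of_nonneg _ _ hI.le, min_mul_of_nonneg _ _ hR.le]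
  refine min_le_min ?_ (by linarith)
  rw [mul_div_assoc', le_div_iff₀ hmp]
  -- Both cardinalities are at least `R` and they sum to `m`. This makes the bound insensitive to
  -- the proportion of nulls.
  have : R * m ≤ 2 * (I.card * Iᶜ.card) := by
    rw [← hm]
    nlinarith
  calc τ * (1 - ν) / 2 * R * m = τ * (1 - ν) / 2 * (R * m) := by ring
    _ ≤ τ * (1 - ν) / 2 * (2 * (I.card * Iᶜ.card)) := by gcongr
    _ = _ := by ring

/-- The constant in the bound of the probability of irregular p-values. -/
noncomputable def irregConst (C τ ν δ : ℝ) : ℝ :=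
  2 * C * (1 + δ) / (δ ^ 3 * min (τ * (1 - ν) / 2) 1) + 2 * C / (δ ^ 2 * (1 - ν) ^ 2)

theorem measure_not_regular_gridStart_le (hξ : ∀ j k, StdPair (ξ j) (ξ k) (r j k) μ)
    (hr : ∀ j, ∑ k, |r j k| ≤ C) (hC : 0 ≤ C) (hν : ν ∈ Set.Ico (0 : ℝ) 1)
    (hδ : 0 < δ) {τ : ℝ} (hτ : 0 < τ) {R : ℝ} (hR : 0 < R)
    (h0 : R ≤ I.card) (h1 : R ≤ Iᶜ.card) :
    μ {ω | ¬ Regular ν δ (gridStart τ ν I) I fun j => pValue (ξ j ω)} ≤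
      ENNReal.ofReal (irregConst C τ ν δ / R) := by
  obtain ⟨hs, hle⟩ := gridStart_mul_card hτ hν.2 hR h0 h1
  have hI : 0 < I.card := by exact_mod_cast hR.trans_le h0
  have hν' : 0 < 1 - ν := by linarith [hν.2]
  refine (measure_not_regular_le hξ hr hC hI hν hδ hs).trans (ENNReal.ofReal_le_ofReal ?_)
  have hmin : 0 < min (τ * (1 - ν) / 2) 1 := lt_min (by positivity) one_pos
  unfold irregConst
  rw [add_div, div_div, div_div, mul_assoc (δ ^ 3)]
  gcongr

end Irregular

/-! ### The normalized contrast as a function of the design. -/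

section Contrast

variable {Ω : Type*} [MeasurableSpace Ω] {n p : ℕ}

/-- Cramer's rule: determinant and adjugate are continuous, and the zero value at singular matrices
agrees with real inversion at zero. -/
theorem measurable_inv_apply {ι : Type*} [Fintype ι] [DecidableEq ι] {A : Ω → Matrix ι ι ℝ}
    (hA : ∀ i j, Measurable fun ω => A ω i j) (i j : ι) : Measurable fun ω => (A ω)⁻¹ i j := by
  have hA' : Measurable fun ω => (fun i j => A ω i j : ι → ι → ℝ) :=
    measurable_pi_lambda _ fun i => measurable_pi_lambda _ fun j => hA i j
  have hof : Continuous fun f : ι → ι → ℝ => (Matrix.of f : Matrix ι ι ℝ) := continuous_id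
  have hdet : Measurable fun ω => (A ω).det :=
    hof.matrix_det.measurable.comp hA'
  have hadj : Measurable fun ω => (A ω).adjugate i j :=
    (hof.matrix_adjugate.matrix_elem i j).measurable.comp hA'
  simp_rw [Matrix.inv_def, Matrix.smul_apply, Ring.inverse_eq_inv', smul_eq_mul]
  exact hdet.inv.mul hadj

/-- `Q(X) 1`. -/
noncomputable def contrast (x : Fin n → Fin p → ℝ) : Fin n → ℝ :=
  (Q (Matrix.of x)).mulVec fun _ => 1

/-- `√(1' Q(X) 1)`. -/
noncomputable def contrastNorm (x : Fin n → Fin p → ℝ) : ℝ :=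
  Real.sqrt ((fun _ => (1 : ℝ)) ⬝ᵥ contrast x)

/-- `Q(X) 1 / √(1' Q(X) 1)`. -/
noncomputable def unitContrast (x : Fin n → Fin p → ℝ) : Fin n → ℝ :=
  (contrastNorm x)⁻¹ • contrast x

theorem measurable_contrast : Measurable (contrast : (Fin n → Fin p → ℝ) → Fin n → ℝ) := by
  have hX : ∀ i j, Measurable fun x : Fin n → Fin p → ℝ => Matrix.of x i j := fun i j => by
    simp only [Matrix.of_apply]
    fun_prop
  have hXX : ∀ i j, Measurable fun x : Fin n → Fin p → ℝ =>
      ((Matrix.of x).transpose * Matrix.of x) i j := fun i j => by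
    simp only [Matrix.mul_apply, Matrix.transpose_apply]
    exact Finset.measurable_sum _ fun k _ => (hX k i).mul (hX k j)
  have hinv := measurable_inv_apply hXX
  refine measurable_pi_lambda _ fun i => ?_
  simp only [contrast, Q, Matrix.mulVec, dotProduct, Matrix.sub_apply, Matrix.mul_apply,
    Matrix.transpose_apply, mul_one]
  exact Finset.measurable_sum _ fun k _ => measurable_const.sub
    (Finset.measurable_sum _ fun l _ => (Finset.measurable_sum _ fun l' _ =>
      (hX i l').mul (hinv l' l)).mul (hX k l))

theorem measurable_contrastNorm :
    Measurable (contrastNorm : (Fin n → Fin p → ℝ) → ℝ) := by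
  have := fun i => (measurable_pi_apply i).comp (measurable_contrast (n := n) (p := p))
  refine Real.continuous_sqrt.measurable.comp ?_
  simp only [dotProduct, one_mul]
  exact Finset.measurable_sum _ fun i _ => this i

theorem measurable_unitContrast :
    Measurable (unitContrast : (Fin n → Fin p → ℝ) → Fin n → ℝ) :=
  measurable_contrastNorm.inv.smul measurable_contrast

variable {b : ℝ} {x : Fin n → Fin p → ℝ}

theorem DesignBound.le_contrastNorm (h : DesignBound b (Matrix.of x)) (hb : 0 < b) :
    Real.sqrt (n * b) ≤ contrastNorm x :=
  Real.sqrt_le_sqrt (h.le_dotProduct_Q hb)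

theorem DesignBound.contrastNorm_pos (h : DesignBound b (Matrix.of x)) (hb : 0 < b) :
    0 < contrastNorm x := by
  have hn : (0 : ℝ) < n := by exact_mod_cast h.pos hb
  exact (Real.sqrt_pos.2 (by positivity)).trans_le (h.le_contrastNorm hb)

theorem DesignBound.sum_contrast (h : DesignBound b (Matrix.of x)) (hb : 0 < b) :
    ∑ i, contrast x i = contrastNorm x ^ 2 := by
  have hn : (0 : ℝ) < n := by exact_mod_cast h.pos hb
  have h1 := h.le_dotProduct_Q hb
  have h2 : (0 : ℝ) ≤ n * b := by positivity
  rw [contrastNorm, contrast, Real.sq_sqrt (h2.trans h1)]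
  simp [dotProduct]

theorem DesignBound.sum_unitContrast_sq (h : DesignBound b (Matrix.of x)) (hb : 0 < b) :
    ∑ i, unitContrast x i ^ 2 = 1 := by
  have h1 := h.contrastNorm_pos hb
  have h2 : ∑ i, contrast x i ^ 2 = contrastNorm x ^ 2 := by
    have := h.dotProduct_Q hb fun _ => 1
    rw [← h.sum_contrast hb]
    simp only [dotProduct, one_mul] at this
    simp only [contrast, pow_two]
    exact this.symm
  simp only [unitContrast, Pi.smul_apply, smul_eq_mul, mul_pow, ← Finset.mul_sum, h2]
  field_simp

theorem DesignBound.sum_mul_contrast (h : DesignBound b (Matrix.of x)) (hb : 0 < b) (l : Fin p) :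
    ∑ i, x i l * contrast x i = 0 := by
  have := congrFun (h.transpose_mulVec_Q hb fun _ => 1) l
  simpa [Matrix.mulVec, dotProduct, contrast] using this

end Contrast

/-! ### Signal plus noise form of the oracle statistics. -/

namespace FactorModel

variable {Ω : Type*} [MeasurableSpace Ω] {p q m n : ℕ} (M : FactorModel Ω p q m n)
  {P : Measure Ω} {b bmax : ℝ}

/-- The covariance matrix of the noise vectors. -/
noncomputable def noiseCov : Matrix (Fin q ⊕ Fin m) (Fin q ⊕ Fin m) ℝ :=
  Matrix.fromBlocks 1 0 0 M.covE

/-- The unit combination of the noise vectors entering the test statistics. -/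
noncomputable def noiseComb (ω : Ω) : EuclideanSpace ℝ (Fin q ⊕ Fin m) :=
  ∑ i, unitContrast (M.x ω) i • M.noise i ω

/-- The standardized error of the `j`-th test statistic. -/
noncomputable def stdError (j : Fin m) (g : EuclideanSpace ℝ (Fin q ⊕ Fin m)) : ℝ :=
  g (Sum.inr j) / Real.sqrt (M.covE j j)

theorem noiseCov_posSemidef (h : M.covE.PosSemidef) : M.noiseCov.PosSemidef := by
  refine Matrix.PosSemidef.of_dotProduct_mulVec_nonneg ?_ fun v => ?_
  · exact Matrix.IsHermitian.fromBlocks Matrix.isHermitian_one (by simp) h.1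
  · have h1 := h.dotProduct_mulVec_nonneg (v ∘ Sum.inr)
    have h2 := (Matrix.PosSemidef.one (n := Fin q) (R := ℝ)).dotProduct_mulVec_nonneg (v ∘ Sum.inl)
    rw [noiseCov, Matrix.fromBlocks_mulVec, dotProduct, Fintype.sum_sum_type]
    simp only [Sum.elim_inl, Sum.elim_inr, Matrix.zero_mulVec, add_zero, zero_add]
    exact add_nonneg h2 h1

theorem stdPair_stdError (h : M.covE.PosSemidef) (hpos : ∀ j, 0 < M.covE j j) (j k : Fin m) :
    StdPair (M.stdError j) (M.stdError k)
      (M.covE j k / (Real.sqrt (M.covE j j) * Real.sqrt (M.covE k k)))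
      (multivariateGaussian 0 M.noiseCov) :=
  stdPair_multivariateGaussian (i := Sum.inr j) (j := Sum.inr k) (M.noiseCov_posSemidef h)
    (hpos j) (hpos k)

theorem sum_abs_corr_le (hb : 0 < b) (h : M.ErrorCov b bmax) (j : Fin m) :
    ∑ k, |M.covE j k / (Real.sqrt (M.covE j j) * Real.sqrt (M.covE k k))| ≤ bmax / b := by
  have h1 : ∑ k, |M.covE j k| ≤ bmax :=
    (le_ciSup (f := fun j => ∑ k, |M.covE j k|) (Set.finite_range _).bddAbove j).trans h.1
  calc ∑ k, |M.covE j k / (Real.sqrt (M.covE j j) * Real.sqrt (M.covE k k))|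
      ≤ ∑ k, |M.covE j k| / b := by
        refine Finset.sum_le_sum fun k _ => ?_
        rw [abs_div, abs_of_nonneg (mul_nonneg (Real.sqrt_nonneg _) (Real.sqrt_nonneg _))]
        refine div_le_div_of_nonneg_left (abs_nonneg _) hb ?_
        calc b = Real.sqrt b * Real.sqrt b := (Real.mul_self_sqrt hb.le).symm
          _ ≤ _ := mul_le_mul (Real.sqrt_le_sqrt (h.2 j).1) (Real.sqrt_le_sqrt (h.2 k).1)
            (Real.sqrt_nonneg _) (Real.sqrt_nonneg _)
    _ = (∑ k, |M.covE j k|) / b := (Finset.sum_div _ _ _).symm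
    _ ≤ bmax / b := by gcongr

/-- Orthogonality of the contrast to the columns of `X` kills `XB`, the subtraction of `Γ'ζ` cancels
`ZΓ`, and the entries of the contrast sum to `c_n²`. -/
theorem Tora_eq (hb : 0 < b) {ω : Ω} (h : DesignBound b (M.X ω)) (j : Fin m) :
    M.Tora ω j = contrastNorm (M.x ω) * M.alpha ω j / Real.sqrt (M.covE j j) +
      M.stdError j (M.noiseComb ω) := by
  have hd : DesignBound b (Matrix.of (M.x ω)) := h
  have hc := hd.contrastNorm_pos hb
  rw [Tora, stdError, ← add_div]
  congr 1
  have hcdef : M.c ω = contrastNorm (M.x ω) := rfl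
  have hQ : M.QXone ω = contrast (M.x ω) := rfl
  have hG : M.noiseComb ω (Sum.inr j) = (M.c ω)⁻¹ * ∑ i, M.eps ω i j * contrast (M.x ω) i := by
    rw [Finset.mul_sum]
    simp [noiseComb, noise, unitContrast, hcdef]
    exact Finset.sum_congr rfl fun i _ => by ring
  have hv : M.vartheta ω j = (M.c ω)⁻¹ * (M.alpha ω j * ∑ i, contrast (M.x ω) i
      + ∑ l, M.beta ω j l * ∑ i, M.x ω i l * contrast (M.x ω) i
      + ∑ l, M.gamma ω j l * ∑ i, M.z ω i l * contrast (M.x ω) i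
      + ∑ i, M.eps ω i j * contrast (M.x ω) i) := by
    have hsw : ∀ {r : ℕ} (f : Fin r → ℝ) (g : Fin n → Fin r → ℝ),
        ∑ l, f l * ∑ i, g i l = ∑ i, ∑ l, f l * g i l := fun f g => by
      simp_rw [Finset.mul_sum]
      exact Finset.sum_comm
    have hY : ∀ i, M.Y ω i j * contrast (M.x ω) i = M.alpha ω j * contrast (M.x ω) i
        + ∑ l, M.beta ω j l * (M.x ω i l * contrast (M.x ω) i)
        + ∑ l, M.gamma ω j l * (M.z ω i l * contrast (M.x ω) i)
        + M.eps ω i j * contrast (M.x ω) i := fun i => by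
      simp only [Y, Matrix.add_apply, Matrix.vecMulVec_apply, Matrix.mul_apply, X, Z,
        B, Gam, E, Matrix.of_apply, one_mul, Matrix.transpose_apply, add_mul, Finset.sum_mul]
      refine congrArg₂ _ (congrArg₂ _ (congrArg₂ _ rfl ?_) ?_) rfl <;>
        exact Finset.sum_congr rfl fun l _ => by ring
    simp only [vartheta, Pi.smul_apply, smul_eq_mul, Matrix.mulVec, dotProduct, hQ,
      Matrix.transpose_apply]
    rw [Finset.sum_congr rfl fun i _ => hY i, Finset.sum_add_distrib, Finset.sum_add_distrib,
      Finset.sum_add_distrib, ← Finset.mul_sum, hsw, hsw]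
  have hz : (M.Gam ω).transpose.mulVec (M.zeta ω) j =
      (M.c ω)⁻¹ * ∑ l, M.gamma ω j l * ∑ i, M.z ω i l * contrast (M.x ω) i := by
    simp only [zeta, Matrix.mulVec, dotProduct, Pi.smul_apply, smul_eq_mul, hQ,
      Matrix.transpose_apply, Z, Gam, Matrix.of_apply]
    rw [Finset.mul_sum]
    exact Finset.sum_congr rfl fun l _ => by ring
  rw [hv, hz, hG, hd.sum_contrast hb]
  simp only [hd.sum_mul_contrast hb, mul_zero, Finset.sum_const_zero, hcdef]
  field_simp
  ring

theorem measurableSet_mem_I₀ (j : Fin m) : MeasurableSet {ω | j ∈ M.I₀ ω} := by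
  simp only [I₀, Finset.mem_filter, Finset.mem_univ, true_and]
  exact ((measurable_pi_apply j).comp M.measurable_alpha) (measurableSet_singleton 0)

theorem measurable_m₀ : Measurable fun ω => (M.m₀ ω : ℝ) := by
  -- With all p-values equal to the threshold, everything is rejected and `V` counts the nulls.
  have := measurable_V (p := fun _ _ => 0) (T := fun _ => 0) M.measurableSet_mem_I₀
    measurable_const measurable_const
  simpa [V, m₀] using this

theorem measurable_m₁ : Measurable fun ω => (M.m₁ ω : ℝ) := by
  have := measurable_S (p := fun _ _ => 0) (T := fun _ => 0) M.measurableSet_mem_I₀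
    measurable_const measurable_const
  simpa [S, m₁] using this

theorem measurable_pora : Measurable M.pora := by
  have hα := fun j => (measurable_pi_apply j).comp M.measurable_alpha
  have hβ := fun j l => (measurable_pi_apply l).comp ((measurable_pi_apply j).comp M.measurable_beta)
  have hγ := fun j l => (measurable_pi_apply l).comp ((measurable_pi_apply j).comp M.measurable_gamma)
  have hx := fun j l => (measurable_pi_apply l).comp ((measurable_pi_apply j).comp M.measurable_x)
  have hz := fun j l => (measurable_pi_apply l).comp ((measurable_pi_apply j).comp M.measurable_z)
  have he := fun j l => (measurable_pi_apply l).comp ((measurable_pi_apply j).comp M.measurable_eps)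
  have hQ : ∀ i, Measurable fun ω => M.QXone ω i := fun i =>
    (measurable_pi_apply i).comp (measurable_contrast.comp M.measurable_x)
  have hc : Measurable M.c := measurable_contrastNorm.comp M.measurable_x
  have hY : ∀ i j, Measurable fun ω => M.Y ω i j := fun i j => by
    simp only [Y, Matrix.add_apply, Matrix.vecMulVec_apply, Matrix.mul_apply, X, Z,
      B, Gam, E, Matrix.of_apply, one_mul, Matrix.transpose_apply]
    exact (((hα j).add (Finset.measurable_sum _ fun l _ => (hx i l).mul (hβ j l))).add
      (Finset.measurable_sum _ fun l _ => (hz i l).mul (hγ j l))).add (he i j)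
  refine measurable_pi_lambda _ fun j => measurable_pValue.comp (Measurable.div_const ?_ _)
  refine Measurable.sub ?_ ?_
  · simp only [vartheta, Pi.smul_apply, smul_eq_mul, Matrix.mulVec, dotProduct,
      Matrix.transpose_apply]
    exact hc.inv.mul (Finset.measurable_sum _ fun i _ => (hY i j).mul (hQ i))
  · simp only [zeta, Matrix.mulVec, dotProduct, Pi.smul_apply, smul_eq_mul,
      Matrix.transpose_apply, Z, Gam, Matrix.of_apply]
    exact Finset.measurable_sum _ fun l _ => (hγ j l).mul
      (hc.inv.mul (Finset.measurable_sum _ fun i _ => (hz i l).mul (hQ i)))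

theorem integrable_fdpOra [IsProbabilityMeasure P] {τ ν : ℝ} (hτ : 0 < τ) (hν : ν < 1) :
    Integrable (M.fdpOra τ ν) P := by
  have hT := measurable_tStar hτ hν M.measurable_pora
  have hm : Measurable (M.fdpOra τ ν) :=
    (measurable_V M.measurableSet_mem_I₀ M.measurable_pora hT).div
      ((measurable_R M.measurable_pora hT).max measurable_const)
  refine Integrable.of_bound hm.aestronglyMeasurable 1 (Filter.Eventually.of_forall fun ω => ?_)
  exact (Real.norm_of_nonneg (FDP_nonneg _)).trans_le (FDP_le_one _)

theorem integrable_powOra [IsProbabilityMeasure P] {τ ν : ℝ} (hτ : 0 < τ) (hν : ν < 1) :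
    Integrable (M.powOra τ ν) P := by
  have hT := measurable_tStar hτ hν M.measurable_pora
  have hm : Measurable (M.powOra τ ν) :=
    (measurable_S M.measurableSet_mem_I₀ M.measurable_pora hT).div (M.measurable_m₁.max measurable_const)
  refine Integrable.of_bound hm.aestronglyMeasurable 1 (Filter.Eventually.of_forall fun ω => ?_)
  exact (Real.norm_of_nonneg (POW_nonneg _)).trans_le (POW_le_one _)

end FactorModel

/-! ### Transfer from random nulls and design to a fixed Gaussian law. -/

namespace FactorModel

variable {Ω : Type*} [MeasurableSpace Ω] {p q m n : ℕ} (M : FactorModel Ω p q m n)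
  {P : Measure Ω} [IsProbabilityMeasure P] {b bmax : ℝ}

/-- The combined noise is independent of `(α, X)`, and its law does not depend on `X`. -/
theorem map_prodMk_noiseComb (hb : 0 < b) (hD : ∀ᵐ ω ∂P, DesignBound b (M.X ω))
    (hN : M.Normality P) (hI : M.ParamIndep P) :
    P.map (fun ω => ((M.alpha ω, M.x ω), M.noiseComb ω)) =
      (P.map fun ω => (M.alpha ω, M.x ω)).prod (multivariateGaussian 0 M.noiseCov) := by
  obtain ⟨hS, hind, hlaw, hx⟩ := hN
  have mα := M.measurable_alpha
  have mβ := M.measurable_beta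
  have mγ := M.measurable_gamma
  have mx := M.measurable_x
  have mz := M.measurable_z
  have me := M.measurable_eps
  have h1 : IndepFun (fun ω => (M.alpha ω, M.x ω)) (fun ω => (M.z ω, M.eps ω)) P :=
    (IndepFun.prodMk_left_of_prodMk_right (mα.prodMk (mβ.prodMk mγ)) mx (mz.prodMk me) hI
      hx.symm).comp (φ := fun a => (a.1.1, a.2)) (by fun_prop) measurable_id
  let Φ : ((Fin m → ℝ) × (Fin n → Fin p → ℝ)) → ((Fin n → Fin q → ℝ) × (Fin n → Fin m → ℝ)) →
      EuclideanSpace ℝ (Fin q ⊕ Fin m) := fun a w =>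
    ∑ i, unitContrast a.2 i • WithLp.toLp 2 (Sum.elim (w.1 i) (w.2 i))
  have hΦ : Measurable (Function.uncurry Φ) := by
    refine Finset.measurable_sum _ fun i _ => Measurable.fun_smul ?_ ?_
    · exact (measurable_pi_apply i).comp
        (measurable_unitContrast.comp (measurable_snd.comp measurable_fst))
    · refine (WithLp.measurable_toLp 2 _).comp (measurable_pi_lambda _ fun k => ?_)
      rcases k with k | k
      · simp only [Sum.elim_inl]
        fun_prop
      · simp only [Sum.elim_inr]
        fun_prop
  -- Only designs with a unit contrast give the fixed law; `D` collects them and has full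
  -- probability.
  refine map_prodMk_eq_prod_of_indepFun (A := fun ω => (M.alpha ω, M.x ω))
    (B := fun ω => (M.z ω, M.eps ω)) (mα.prodMk mx) (mz.prodMk me) h1 hΦ
    (D := {a | ∑ i, unitContrast a.2 i ^ 2 = 1}) ?_ ?_ fun a ha => ?_
  · have : ∀ i, Measurable fun a : (Fin m → ℝ) × (Fin n → Fin p → ℝ) => unitContrast a.2 i :=
      fun i => (measurable_pi_apply i).comp (measurable_unitContrast.comp measurable_snd)
    exact (Finset.measurable_sum Finset.univ fun i _ => (this i).pow_const 2)
      (measurableSet_singleton 1)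
  · filter_upwards [hD] with ω hω
    exact DesignBound.sum_unitContrast_sq hω hb
  · exact (hasLaw_sum_smul_multivariateGaussian (M.noiseCov_posSemidef hS) hind hlaw ha).map_eq

theorem measure_alpha_mem_inter_le (hb : 0 < b) (hD : ∀ᵐ ω ∂P, DesignBound b (M.X ω))
    (hN : M.Normality P) (hI : M.ParamIndep P) {s : Set (Fin m → ℝ)} (hs : MeasurableSet s)
    (B : Set (EuclideanSpace ℝ (Fin q ⊕ Fin m))) :
    P {ω | M.alpha ω ∈ s ∧ M.noiseComb ω ∈ B} ≤
      P {ω | M.alpha ω ∈ s} * multivariateGaussian 0 M.noiseCov B := by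
  have hprod := M.map_prodMk_noiseComb hb hD hN hI
  set μ := multivariateGaussian 0 M.noiseCov
  have hA : Measurable fun ω => (M.alpha ω, M.x ω) := M.measurable_alpha.prodMk M.measurable_x
  have hG : AEMeasurable (fun ω => ((M.alpha ω, M.x ω), M.noiseComb ω)) P := by
    -- A map that is not a.e. measurable has zero pushforward, whereas here it is a probability
    -- measure.
    refine AEMeasurable.of_map_ne_zero ?_
    rw [hprod]
    have := Measure.isProbabilityMeasure_map (μ := P) hA.aemeasurable
    exact IsProbabilityMeasure.ne_zero _
  have hs' : MeasurableSet ((Prod.fst : (Fin m → ℝ) × (Fin n → Fin p → ℝ) → _) ⁻¹' s) :=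
    measurable_fst hs
  have hB := measurableSet_toMeasurable μ B
  calc P {ω | M.alpha ω ∈ s ∧ M.noiseComb ω ∈ B}
      ≤ P ((fun ω => ((M.alpha ω, M.x ω), M.noiseComb ω)) ⁻¹'
          ((Prod.fst ⁻¹' s) ×ˢ toMeasurable μ B)) :=
        measure_mono fun ω hω => ⟨hω.1, subset_toMeasurable μ B hω.2⟩
    _ = (P.map fun ω => (M.alpha ω, M.x ω)) (Prod.fst ⁻¹' s) * μ (toMeasurable μ B) := by
        rw [← Measure.map_apply_of_aemeasurable hG (hs'.prod hB), hprod, Measure.prod_prod]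
    _ = _ := by
        rw [Measure.map_apply hA hs', measure_toMeasurable]
        rfl

/-- p-values of the standardized errors. -/
noncomputable def nullP (ω : Ω) (j : Fin m) : ℝ := pValue (M.stdError j (M.noiseComb ω))

theorem measure_exists_nullP_le (hb : 0 < b) (hD : ∀ᵐ ω ∂P, DesignBound b (M.X ω))
    (hN : M.Normality P) (hI : M.ParamIndep P) (hE : M.ErrorCov b bmax) {t : ℝ} (ht : 0 ≤ t) :
    P {ω | ∃ j, M.nullP ω j ≤ t} ≤ ENNReal.ofReal (m * t) := by
  have h := M.measure_alpha_mem_inter_le hb hD hN hI MeasurableSet.univ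
    {g | ∃ j, pValue (M.stdError j g) ≤ t}
  have h2 := measure_exists_pValue_le
    (M.stdPair_stdError hN.1 fun j => hb.trans_le (hE.2 j).1) ht
  simp only [Set.mem_univ, true_and] at h
  refine h.trans ((mul_le_of_le_one_left' prob_le_one).trans h2)

theorem measurableSet_filter_eq_zero (I : Finset (Fin m)) :
    MeasurableSet {a : Fin m → ℝ | (Finset.univ.filter fun j => a j = 0) = I} := by
  have : {a : Fin m → ℝ | (Finset.univ.filter fun j => a j = 0) = I} =
      ⋂ j, {a | a j = 0 ↔ j ∈ I} := by
    ext a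
    simp [Finset.ext_iff]
  rw [this]
  refine MeasurableSet.iInter fun j => ?_
  have h0 : MeasurableSet {a : Fin m → ℝ | a j = 0} :=
    (measurable_pi_apply j) (measurableSet_singleton 0)
  by_cases hj : j ∈ I
  · simpa [hj] using h0
  · simp only [hj, iff_false]
    exact h0.compl

/-- The set of nulls is random, but it has finitely many values and depends on `α` only. On each
value `I` independence gives the bound for a fixed set times `P (I₀ = I)`, and these weights sum to
one. -/
theorem measure_not_regular_le (hb : 0 < b) (hbm : 0 ≤ bmax)
    (hD : ∀ᵐ ω ∂P, DesignBound b (M.X ω))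
    (hN : M.Normality P) (hI : M.ParamIndep P) (hE : M.ErrorCov b bmax) {τ ν δ R : ℝ}
    (hτ : 0 < τ) (hν : ν ∈ Set.Ico (0 : ℝ) 1) (hδ : 0 < δ) (hR : 0 < R) :
    P {ω | (R ≤ M.m₀ ω ∧ R ≤ M.m₁ ω) ∧
      ¬ Regular ν δ (gridStart τ ν (M.I₀ ω)) (M.I₀ ω) (M.nullP ω)} ≤
      ENNReal.ofReal (irregConst (bmax / b) τ ν δ / R) := by
  set K := ENNReal.ofReal (irregConst (bmax / b) τ ν δ / R)
  set Bad : Finset (Fin m) → Set Ω := fun I => {ω | (R ≤ I.card ∧ R ≤ Iᶜ.card) ∧ M.I₀ ω = I ∧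
      ¬ Regular ν δ (gridStart τ ν I) I (M.nullP ω)}
  have hbad : ∀ I, P (Bad I) ≤ P (M.I₀ ⁻¹' {I}) * K := fun I => by
    by_cases hRI : R ≤ I.card ∧ R ≤ Iᶜ.card
    · have h := M.measure_alpha_mem_inter_le hb hD hN hI (measurableSet_filter_eq_zero I)
        {g | ¬ Regular ν δ (gridStart τ ν I) I fun j => pValue (M.stdError j g)}
      have h2 := measure_not_regular_gridStart_le (I := I)
        (M.stdPair_stdError hN.1 fun j => hb.trans_le (hE.2 j).1)
        (M.sum_abs_corr_le hb hE) (by positivity) hν hδ hτ hR hRI.1 hRI.2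
      refine (measure_mono ?_).trans (h.trans (mul_le_mul_right h2 _))
      exact fun ω hω => hω.2
    · have : Bad I = ∅ := by
        ext ω
        simp only [Bad, hRI, false_and]
        rfl
      simp [this]
  have hmI : ∀ I, MeasurableSet (M.I₀ ⁻¹' {I}) := fun I =>
    M.measurable_alpha (measurableSet_filter_eq_zero I)
  calc P {ω | (R ≤ M.m₀ ω ∧ R ≤ M.m₁ ω) ∧
      ¬ Regular ν δ (gridStart τ ν (M.I₀ ω)) (M.I₀ ω) (M.nullP ω)}
      ≤ P (⋃ I, Bad I) :=
        measure_mono fun ω hω => Set.mem_iUnion.2 ⟨M.I₀ ω, hω.1, rfl, hω.2⟩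
    _ ≤ ∑ I, P (Bad I) := measure_iUnion_fintype_le _ _
    _ ≤ ∑ I, P (M.I₀ ⁻¹' {I}) * K := Finset.sum_le_sum fun I _ => hbad I
    _ = P (M.I₀ ⁻¹' ↑(Finset.univ : Finset (Finset (Fin m)))) * K := by
        rw [← Finset.sum_mul, sum_measure_preimage_singleton _ fun I _ => hmI I]
    _ ≤ K := mul_le_of_le_one_left' prob_le_one

end FactorModel

/-- A lower bound for the mean of the test statistics of the alternatives. -/
noncomputable def signal (b bmax : ℝ) (n : ℕ) : ℝ := b * Real.sqrt (n * b) / Real.sqrt bmax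

/-! ### Strong alternatives and the failure events. -/

namespace FactorModel

variable {Ω : Type*} [MeasurableSpace Ω] {p q m n : ℕ} (M : FactorModel Ω p q m n)
  {b bmax : ℝ} {ω : Ω}

theorem pora_eq_nullP (hb : 0 < b) (h : DesignBound b (M.X ω)) {j : Fin m}
    (hj : j ∈ M.I₀ ω) : M.pora ω j = M.nullP ω j := by
  have : M.alpha ω j = 0 := by simpa [I₀] using hj
  rw [pora, M.Tora_eq hb h, this, nullP]
  simp

/-- The condition on the `nullP` says that every error is below half the signal; by the triangle
inequality the alternatives' statistics exceed the other half. -/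
theorem pora_le_of_forall_lt_nullP (hb : 0 < b) (h : DesignBound b (M.X ω))
    (hE : M.ErrorCov b bmax) (hα : ∀ j ∉ M.I₀ ω, b ≤ |M.alpha ω j|)
    (hlt : ∀ j, pValue (signal b bmax n / 2) < M.nullP ω j) {j : Fin m} (hj : j ∉ M.I₀ ω) :
    M.pora ω j ≤ pValue (signal b bmax n / 2) := by
  have hσ := hE.2 j
  have hs0 : 0 < Real.sqrt (M.covE j j) := Real.sqrt_pos.2 (hb.trans_le hσ.1)
  have hnn : 0 ≤ signal b bmax n := by unfold signal; positivity
  have hξ : |M.stdError j (M.noiseComb ω)| < signal b bmax n / 2 := by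
    by_contra hcon
    refine (hlt j).not_ge (pValue_anti ?_)
    rw [abs_of_nonneg (by linarith)]
    exact not_lt.1 hcon
  have hsig : signal b bmax n ≤
      |contrastNorm (M.x ω) * M.alpha ω j / Real.sqrt (M.covE j j)| := by
    have hc : Real.sqrt (n * b) ≤ contrastNorm (M.x ω) := DesignBound.le_contrastNorm h hb
    rw [abs_div, abs_mul, abs_of_pos hs0,
      abs_of_nonneg ((Real.sqrt_nonneg _).trans hc), signal, mul_comm b]
    have := hα j hj
    have := Real.sqrt_le_sqrt hσ.2
    have := (Real.sqrt_nonneg _).trans hc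
    gcongr
  refine pValue_anti ?_
  rw [M.Tora_eq hb h, abs_of_nonneg (by linarith)]
  set A := contrastNorm (M.x ω) * M.alpha ω j / Real.sqrt (M.covE j j)
  set B := M.stdError j (M.noiseComb ω)
  have : |A| ≤ |A + B| + |B| := by
    have := abs_sub (A + B) B
    rwa [add_sub_cancel_right] at this
  linarith

variable {τ ν δ : ℝ}

theorem gridStart_le_tStar (hτ : 0 < τ) (hν : ν < 1)
    (hα : ∀ j ∉ M.I₀ ω, M.pora ω j ≤ pValue (signal b bmax n / 2))
    (hm : m * pValue (signal b bmax n / 2) ≤ τ * (1 - ν)) (h1 : pValue (signal b bmax n / 2) ≤ 1)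
    (hI : 0 < M.m₁ ω) :
    (∀ j ∉ M.I₀ ω, M.pora ω j ≤ gridStart τ ν (M.I₀ ω)) ∧ 0 < gridStart τ ν (M.I₀ ω) ∧
      gridStart τ ν (M.I₀ ω) ≤ tStar τ ν (M.pora ω) := by
  have hν' : 0 < 1 - ν := by linarith
  have hI1 : (1 : ℝ) ≤ (M.I₀ ω)ᶜ.card := by exact_mod_cast hI
  have hmp : (0 : ℝ) < m := by
    have := card_add_card_compl (M.I₀ ω)
    have h0 : (0 : ℝ) ≤ (M.I₀ ω).card := Nat.cast_nonneg _
    linarith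
  have hle : pValue (signal b bmax n / 2) ≤ gridStart τ ν (M.I₀ ω) := by
    refine le_min ?_ h1
    rw [le_div_iff₀ hmp, mul_comm]
    refine hm.trans (le_mul_of_one_le_right (by positivity) hI1)
  have hpos : 0 < gridStart τ ν (M.I₀ ω) := lt_min (by positivity) one_pos
  have hp : ∀ j ∉ M.I₀ ω, M.pora ω j ≤ gridStart τ ν (M.I₀ ω) := fun j hj => (hα j hj).trans hle
  refine ⟨hp, hpos, le_tStar_of_forall_le hτ hν ⟨hpos, min_le_right _ _⟩ hp ?_⟩
  rw [mul_comm, ← le_div_iff₀ hmp]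
  exact min_le_left _ _

variable {P : Measure Ω} [IsProbabilityMeasure P]

/-- Everything that a single model contributes to the asymptotic statement. -/
structure Admissible (M : FactorModel Ω p q m n) (P : Measure Ω) (b bmax : ℝ) : Prop where
  design : ∀ᵐ ω ∂P, DesignBound b (M.X ω)
  normality : M.Normality P
  paramIndep : M.ParamIndep P
  errorCov : M.ErrorCov b bmax
  alpha_ge : ∀ᵐ ω ∂P, ∀ j, j ∉ M.I₀ ω → b ≤ |M.alpha ω j|

theorem Admissible.measure_powOra_ne_one_le {M : FactorModel Ω p q m n}
    (h : M.Admissible P b bmax) (hb : 0 < b) (hτ : 0 < τ) (hν : ν < 1)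
    (hm : m * pValue (signal b bmax n / 2) ≤ τ * (1 - ν))
    (h1 : pValue (signal b bmax n / 2) ≤ 1) {R : ℕ} (hR : 0 < R) :
    P {ω | M.powOra τ ν ω ≠ 1} ≤ ENNReal.ofReal (m * pValue (signal b bmax n / 2)) +
      P {ω | ¬ ((R : ℝ) ≤ M.m₀ ω ∧ (R : ℝ) ≤ M.m₁ ω)} := by
  refine le_trans (measure_mono_ae ?_) ((measure_union_le _ _).trans (add_le_add
    (M.measure_exists_nullP_le hb h.design h.normality h.paramIndep h.errorCov
      (pValue_nonneg (signal b bmax n / 2))) le_rfl))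
  filter_upwards [h.design, h.alpha_ge] with ω hD hα hω
  change ω ∈ (_ ∪ _ : Set Ω)
  by_contra hcon
  rw [Set.mem_union, not_or] at hcon
  obtain ⟨hc1, hc2⟩ := hcon
  have hlt : ∀ j, pValue (signal b bmax n / 2) < M.nullP ω j := fun j =>
    not_le.1 fun hj => hc1 ⟨j, hj⟩
  have hR2 := (not_not.1 hc2).2
  have hI : 0 < M.m₁ ω := hR.trans_le (by exact_mod_cast hR2)
  obtain ⟨g1, -, g3⟩ := M.gridStart_le_tStar hτ hν
    (fun j hj => M.pora_le_of_forall_lt_nullP hb hD h.errorCov hα hlt hj) hm h1 hI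
  exact hω (POW_tStar_eq_one g1 g3 hI)

theorem Admissible.measure_lt_fdpOra_le {M : FactorModel Ω p q m n}
    (h : M.Admissible P b bmax) (hb : 0 < b) (hbm : 0 ≤ bmax) (hτ : 0 < τ)
    (hν : ν ∈ Set.Ico (0 : ℝ) 1) (hδ : 0 < δ) (hδ1 : δ < 1)
    (hm : m * pValue (signal b bmax n / 2) ≤ τ * (1 - ν))
    (h1 : pValue (signal b bmax n / 2) ≤ 1) {R : ℕ} (hR : 0 < R) :
    P {ω | (1 + δ) ^ 2 / (1 - δ) * τ < M.fdpOra τ ν ω} ≤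
      ENNReal.ofReal (m * pValue (signal b bmax n / 2)) +
      P {ω | ¬ ((R : ℝ) ≤ M.m₀ ω ∧ (R : ℝ) ≤ M.m₁ ω)} +
      ENNReal.ofReal (irregConst (bmax / b) τ ν δ / R) := by
  refine le_trans (measure_mono_ae ?_) ((measure_union_le _ _).trans (add_le_add
    ((measure_union_le _ _).trans (add_le_add
      (M.measure_exists_nullP_le hb h.design h.normality h.paramIndep h.errorCov
        (pValue_nonneg (signal b bmax n / 2))) le_rfl))
    (M.measure_not_regular_le hb hbm h.design h.normality h.paramIndep h.errorCov hτ hν hδ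
      (by exact_mod_cast hR))))
  filter_upwards [h.design, h.alpha_ge] with ω hD hα hω
  change ω ∈ (_ ∪ _ ∪ _ : Set Ω)
  by_contra hcon
  rw [Set.mem_union, Set.mem_union, not_or, not_or] at hcon
  obtain ⟨⟨hc1, hc2⟩, hc3⟩ := hcon
  have hlt : ∀ j, pValue (signal b bmax n / 2) < M.nullP ω j := fun j =>
    not_le.1 fun hj => hc1 ⟨j, hj⟩
  have hR2 := not_not.1 hc2
  have hI : 0 < M.m₁ ω := hR.trans_le (by exact_mod_cast hR2.2)
  obtain ⟨-, g2, g3⟩ := M.gridStart_le_tStar hτ hν.2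
    (fun j hj => M.pora_le_of_forall_lt_nullP hb hD h.errorCov hα hlt hj) hm h1 hI
  have hreg : Regular ν δ (gridStart τ ν (M.I₀ ω)) (M.I₀ ω) (M.nullP ω) := by
    by_contra hr
    exact hc3 ⟨hR2, hr⟩
  -- Regularity involves only null p-values, which are those of the pure errors.
  have hV := fun t => V_congr (fun j (hj : j ∈ M.I₀ ω) => M.pora_eq_nullP hb hD hj) t
  have hreg' : Regular ν δ (gridStart τ ν (M.I₀ ω)) (M.I₀ ω) (M.pora ω) := by
    simpa only [Regular, hV] using hreg
  have hω' : (1 + δ) ^ 2 / (1 - δ) * τ < M.fdpOra τ ν ω := hω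
  exact absurd (hreg'.FDP_tStar_le hτ hν.2 hδ hδ1 g2 g3) (not_le.2 hω')

end FactorModel

/-! ### Exponential smallness of the alternatives' p-values. -/

theorem pValue_signal_le {b bmax : ℝ} (hb : 0 < b) (hbm : 0 < bmax) (n : ℕ) :
    pValue (signal b bmax n / 2) ≤ 2 * Real.exp (-(b ^ 3 / (8 * bmax)) * n) := by
  have hnn : 0 ≤ signal b bmax n := by unfold signal; positivity
  refine (pValue_le_exp (by linarith)).trans_eq ?_
  congr 2
  have : signal b bmax n ^ 2 = b ^ 2 * (n * b) / bmax := by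
    unfold signal
    rw [div_pow, mul_pow, Real.sq_sqrt (by positivity), Real.sq_sqrt hbm.le]
  rw [div_pow, this]
  field_simp
  ring

theorem tendsto_pValue_signal {b bmax : ℝ} (hb : 0 < b) (hbm : 0 < bmax) {n : ℕ → ℕ}
    (hn : Tendsto n atTop atTop) :
    Tendsto (fun N => pValue (signal b bmax (n N) / 2)) atTop (𝓝 0) := by
  have hκ : 0 < b ^ 3 / (8 * bmax) := by positivity
  refine squeeze_zero (fun N => pValue_nonneg _) (fun N => pValue_signal_le hb hbm (n N)) ?_
  have h1 : Tendsto (fun N => -(b ^ 3 / (8 * bmax)) * (n N : ℝ)) atTop atBot :=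
    (tendsto_natCast_atTop_atTop.comp hn).const_mul_atTop_of_neg (by linarith)
  simpa using (Real.tendsto_exp_atBot.comp h1).const_mul 2

theorem tendsto_mul_pValue_signal {b bmax : ℝ} (hb : 0 < b) (hbm : 0 < bmax) {m n : ℕ → ℕ}
    (hn : Tendsto n atTop atTop)
    (hlog : (fun N => Real.log (m N : ℝ)) =o[atTop] fun N => (n N : ℝ)) :
    Tendsto (fun N => m N * pValue (signal b bmax (n N) / 2)) atTop (𝓝 0) := by
  set κ := b ^ 3 / (8 * bmax) with hκdef
  have hκ : 0 < κ := by positivity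
  have h1 : Tendsto (fun N => -(κ / 2) * (n N : ℝ)) atTop atBot :=
    (tendsto_natCast_atTop_atTop.comp hn).const_mul_atTop_of_neg (by linarith)
  refine squeeze_zero' (Eventually.of_forall fun N => mul_nonneg (Nat.cast_nonneg _)
    (pValue_nonneg _)) ?_
    (g := fun N => 2 * Real.exp (-(κ / 2) * (n N : ℝ)))
    (by simpa using (Real.tendsto_exp_atBot.comp h1).const_mul 2)
  -- Half of the rate `κ` is spent on absorbing `m`, the other half remains as decay.
  filter_upwards [hlog.bound (half_pos hκ)] with N hN
  have hle : (m N : ℝ) ≤ Real.exp (κ / 2 * n N) := by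
    rcases Nat.eq_zero_or_pos (m N) with h0 | hpos
    · rw [h0]
      simp only [Nat.cast_zero]
      positivity
    · have hm : (0 : ℝ) < m N := by exact_mod_cast hpos
      rw [← Real.log_le_iff_le_exp hm]
      refine (le_abs_self _).trans (hN.trans_eq ?_)
      simp
  calc m N * pValue (signal b bmax (n N) / 2)
      ≤ Real.exp (κ / 2 * n N) * (2 * Real.exp (-κ * n N)) :=
        mul_le_mul hle (pValue_signal_le hb hbm (n N)) (pValue_nonneg _) (Real.exp_pos _).le
    _ = 2 * Real.exp (-(κ / 2) * n N) := by
        rw [mul_left_comm, ← Real.exp_add]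
        congr 2
        ring

/-! ### Passage to the limit. -/

section Limits

variable {Ω : Type*} [MeasurableSpace Ω] {P : Measure Ω} [IsProbabilityMeasure P]
  {p q : ℕ} {m n : ℕ → ℕ} {M : ∀ N, FactorModel Ω p q (m N) (n N)}

/-- Almost sure divergence of the random counts gives almost sure convergence of the indicators to
zero, hence of their probabilities. -/
theorem tendsto_measure_card_lt
    (hmin : ∀ᵐ ω ∂P,
      Tendsto (fun N => min (min ((M N).m₀ ω) ((M N).m₁ ω)) (n N)) atTop atTop) (R : ℕ) :
    Tendsto (fun N => P {ω | ¬ ((R : ℝ) ≤ (M N).m₀ ω ∧ (R : ℝ) ≤ (M N).m₁ ω)}) atTop (𝓝 0) := by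
  have hmeas : ∀ N, MeasurableSet {ω | ¬ ((R : ℝ) ≤ (M N).m₀ ω ∧ (R : ℝ) ≤ (M N).m₁ ω)} :=
    fun N => ((measurableSet_le measurable_const (M N).measurable_m₀).inter
      (measurableSet_le measurable_const (M N).measurable_m₁)).compl
  have := tendsto_measure_of_ae_tendsto_indicator_of_isFiniteMeasure (μ := P) atTop
    MeasurableSet.empty hmeas ?_
  · simpa using this
  · filter_upwards [hmin] with ω hω
    filter_upwards [hω.eventually_ge_atTop R] with N hN
    have h1 : R ≤ (M N).m₀ ω := hN.trans ((min_le_left _ _).trans (min_le_left _ _))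
    have h2 : R ≤ (M N).m₁ ω := hN.trans ((min_le_left _ _).trans (min_le_right _ _))
    simp [h1, h2]

theorem integral_le_add_measure_lt {f : Ω → ℝ} (hf : Integrable f P) (h1 : ∀ ω, f ω ≤ 1)
    {c ε : ℝ} (hc : 0 ≤ c) (hε : 0 ≤ ε) (h : P {ω | c < f ω} ≤ ENNReal.ofReal ε) :
    ∫ ω, f ω ∂P ≤ c + ε := by
  have hs : NullMeasurableSet {ω | c < f ω} P :=
    nullMeasurableSet_lt aemeasurable_const hf.aemeasurable
  have hint : Integrable (fun ω => c + {ω | c < f ω}.indicator (fun _ => (1 : ℝ)) ω) P :=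
    (integrable_const c).add ((integrable_const 1).indicator₀ hs)
  calc ∫ ω, f ω ∂P ≤ ∫ ω, c + {ω | c < f ω}.indicator (fun _ => (1 : ℝ)) ω ∂P := by
        refine integral_mono hf hint fun ω => ?_
        by_cases hω : c < f ω
        · have : ω ∈ {ω | c < f ω} := hω
          simp only [Set.indicator_of_mem this]
          linarith [h1 ω]
        · have : ω ∉ {ω | c < f ω} := hω
          simp only [Set.indicator_of_notMem this]
          linarith
    _ = c + P.real {ω | c < f ω} := by
        rw [integral_add (integrable_const c) ((integrable_const 1).indicator₀ hs),
          integral_indicator₀ hs]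
        simp
    _ ≤ c + ε := by
        gcongr
        exact ENNReal.toReal_le_of_le_ofReal hε h

variable {b bmax τ ν : ℝ}

theorem limsup_fdrOra_le (hA : ∀ N, (M N).Admissible P b bmax) (hb : 0 < b) (hbm : 0 < bmax)
    (hτ : 0 < τ) (hν : ν ∈ Set.Ico (0 : ℝ) 1) (hn : Tendsto n atTop atTop)
    (hlog : (fun N => Real.log (m N : ℝ)) =o[atTop] fun N => (n N : ℝ))
    (hmin : ∀ᵐ ω ∂P,
      Tendsto (fun N => min (min ((M N).m₀ ω) ((M N).m₁ ω)) (n N)) atTop atTop) :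
    limsup (fun N => (M N).fdrOra P τ ν) atTop ≤ τ := by
  refine le_of_forall_pos_le_add fun ε hε => ?_
  refine limsup_le_of_le ⟨0, ?_⟩ ?_
  -- The real `limsup` is meaningful only with a lower bound, provided by nonnegativity of the FDP.
  · intro a ha
    obtain ⟨N, hN⟩ := (eventually_map.1 ha).exists
    exact (integral_nonneg fun ω => FDP_nonneg _).trans hN
  have hν' : 0 < 1 - ν := by linarith [hν.2]
  obtain ⟨δ, hδ, hδ1, hδτ⟩ : ∃ δ : ℝ, 0 < δ ∧ δ < 1 ∧ (1 + δ) ^ 2 / (1 - δ) * τ < τ + ε / 4 := by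
    have hcont : ContinuousAt (fun δ : ℝ => (1 + δ) ^ 2 / (1 - δ) * τ) 0 := by
      refine ContinuousAt.mul (ContinuousAt.div (by fun_prop) (by fun_prop) (by norm_num))
        continuousAt_const
    have h0 : (fun δ : ℝ => (1 + δ) ^ 2 / (1 - δ) * τ) 0 < τ + ε / 4 := by
      simp only [add_zero, one_pow, sub_zero, div_one, one_mul]
      linarith
    have h1 := (hcont.eventually_lt_const h0).filter_mono
      (nhdsWithin_le_nhds (s := Set.Ioi (0 : ℝ)))
    have h2 : ∀ᶠ δ : ℝ in 𝓝[>] 0, δ ∈ Set.Ioo (0 : ℝ) 1 := Ioo_mem_nhdsGT one_pos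
    obtain ⟨δ, hd1, hd2⟩ := (h1.and h2).exists
    exact ⟨δ, hd2.1, hd2.2, hd1⟩
  -- `R` is fixed after `δ` and before `N`. One quarter of `ε` goes to `δ` and one to each of the
  -- three failure events.
  obtain ⟨R, hR⟩ := exists_nat_gt (irregConst (bmax / b) τ ν δ / (ε / 4))
  have hK : 0 ≤ irregConst (bmax / b) τ ν δ := by
    have : 0 < min (τ * (1 - ν) / 2) 1 := lt_min (by positivity) one_pos
    unfold irregConst
    positivity
  have hR0 : (0 : ℝ) < R := lt_of_le_of_lt (by positivity) hR
  have hKR : irregConst (bmax / b) τ ν δ / R ≤ ε / 4 := by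
    rw [div_lt_iff₀ (by positivity)] at hR
    rw [div_le_iff₀ hR0]
    linarith
  have hε4 : (0 : ℝ) < ε / 4 := by positivity
  filter_upwards [(tendsto_mul_pValue_signal hb hbm hn hlog).eventually_le_const
      (show (0 : ℝ) < τ * (1 - ν) by positivity),
    (tendsto_mul_pValue_signal hb hbm hn hlog).eventually_le_const hε4,
    (tendsto_pValue_signal hb hbm hn).eventually_le_const one_pos,
    (tendsto_measure_card_lt hmin R).eventually_le_const (ENNReal.ofReal_pos.2 hε4)]
    with N h1 h2 h3 h4
  have hle := (hA N).measure_lt_fdpOra_le hb hbm.le hτ hν hδ hδ1 h1 h3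
    (R := R) (by exact_mod_cast hR0)
  have hle' : P {ω | (1 + δ) ^ 2 / (1 - δ) * τ < (M N).fdpOra τ ν ω} ≤
      ENNReal.ofReal (3 * (ε / 4)) := by
    refine hle.trans ?_
    calc _ ≤ ENNReal.ofReal (ε / 4) + ENNReal.ofReal (ε / 4) + ENNReal.ofReal (ε / 4) := by
          gcongr
      _ = _ := by
          rw [← ENNReal.ofReal_add hε4.le hε4.le, ← ENNReal.ofReal_add (by positivity) hε4.le]
          congr 1
          ring
  have hδ' : 0 < 1 - δ := by linarith
  have := integral_le_add_measure_lt ((M N).integrable_fdpOra hτ hν.2) (fun ω => FDP_le_one _)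
    (by positivity) (by positivity) hle'
  unfold FactorModel.fdrOra
  linarith

theorem tendsto_integral_powOra (hA : ∀ N, (M N).Admissible P b bmax) (hb : 0 < b)
    (hbm : 0 < bmax) (hτ : 0 < τ) (hν : ν ∈ Set.Ico (0 : ℝ) 1) (hn : Tendsto n atTop atTop)
    (hlog : (fun N => Real.log (m N : ℝ)) =o[atTop] fun N => (n N : ℝ))
    (hmin : ∀ᵐ ω ∂P,
      Tendsto (fun N => min (min ((M N).m₀ ω) ((M N).m₁ ω)) (n N)) atTop atTop) :
    Tendsto (fun N => ∫ ω, (M N).powOra τ ν ω ∂P) atTop (𝓝 1) := by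
  have hν' : 0 < 1 - ν := by linarith [hν.2]
  have hint := fun N => (M N).integrable_powOra (P := P) hτ hν.2
  have hle1 : ∀ N, ∫ ω, (M N).powOra τ ν ω ∂P ≤ 1 := fun N => by
    have := integral_mono (hint N) (integrable_const (1 : ℝ)) fun ω => POW_le_one _
    simpa using this
  refine tendsto_order.2 ⟨fun a ha => ?_, fun a ha => Eventually.of_forall fun N =>
    (hle1 N).trans_lt ha⟩
  have hε : 0 < (1 - a) / 4 := by linarith
  filter_upwards [(tendsto_mul_pValue_signal hb hbm hn hlog).eventually_le_const
      (show (0 : ℝ) < τ * (1 - ν) by positivity),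
    (tendsto_mul_pValue_signal hb hbm hn hlog).eventually_le_const hε,
    (tendsto_pValue_signal hb hbm hn).eventually_le_const one_pos,
    (tendsto_measure_card_lt hmin 1).eventually_le_const (ENNReal.ofReal_pos.2 hε)]
    with N h1 h2 h3 h4
  have hle := (hA N).measure_powOra_ne_one_le hb hτ hν.2 h1 h3 (R := 1) one_pos
  have hle' : P {ω | 0 < 1 - (M N).powOra τ ν ω} ≤ ENNReal.ofReal (2 * ((1 - a) / 4)) := by
    refine (measure_mono fun ω hω => ?_).trans (hle.trans ?_)
    · have hω' : 0 < 1 - (M N).powOra τ ν ω := hω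
      exact fun h => by linarith
    · calc _ ≤ ENNReal.ofReal ((1 - a) / 4) + ENNReal.ofReal ((1 - a) / 4) := by
            gcongr
        _ = _ := by
            rw [← ENNReal.ofReal_add hε.le hε.le]
            congr 1
            ring
  -- Applied to the missing power `1 - POW` with `c = 0`: it is at most one and vanishes off the
  -- failure event.
  have h5 := integral_le_add_measure_lt ((integrable_const (1 : ℝ)).sub (hint N))
    (fun ω => by
      have : 0 ≤ (M N).powOra τ ν ω := POW_nonneg _
      simp only [Pi.sub_apply]
      linarith) le_rfl (by positivity) hle'
  simp only [Pi.sub_apply] at h5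
  rw [integral_sub (integrable_const _) (hint N)] at h5
  simp at h5
  linarith

end Limits

end FAT

theorem proposition1 {Ω : Type*} [MeasurableSpace Ω] (P : Measure Ω) [IsProbabilityMeasure P]
    (p q : ℕ) (m n : ℕ → ℕ)
    (M : ∀ N, FAT.FactorModel Ω p q (m N) (n N))
    (SigG : Matrix (Fin q) (Fin q) ℝ) (bmin bmax h τ ν π₀ : ℝ)
    (hSigG : SigG.PosDef) (hbmin : 0 < bmin) (hb : bmin ≤ bmax) (hh : h < 1)
    (hτ : 0 < τ) (hν : ν ∈ Set.Ico (0 : ℝ) 1) (hπ₀ : π₀ ∈ Set.Icc (0 : ℝ) 1)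
    (hparam : ∀ N, (M N).ParamIndep P)
    (hA : FAT.Assumption1 P M SigG bmin bmax h ∨ FAT.Assumption2 P M SigG bmin bmax)
    (hlim : ∀ᵐ ω ∂P, Tendsto (fun N => ((M N).m₀ ω : ℝ) / (m N : ℝ)) atTop (𝓝 π₀))
    (hlog : (fun N => Real.log (m N : ℝ)) =o[atTop] fun N => (n N : ℝ))
    (hmin : ∀ᵐ ω ∂P,
      Tendsto (fun N => min (min ((M N).m₀ ω) ((M N).m₁ ω)) (n N)) atTop atTop) :
    ((∀ N, Integrable ((M N).fdpOra τ ν) P) ∧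
      limsup (fun N => (M N).fdrOra P τ ν) atTop ≤ τ) ∧
    ((∀ N, Integrable ((M N).powOra τ ν) P) ∧
      Tendsto (fun N => ∫ ω, (M N).powOra τ ν ω ∂P) atTop (𝓝 1)) := by
  have hD : ∀ N, (M N).Design P bmin bmax → ∀ᵐ ω ∂P, FAT.DesignBound bmin ((M N).X ω) :=
    fun N hD => hD.mono fun ω hω l hl => (hω l hl).1
  have hadm : ∀ N, (M N).Admissible P bmin bmax := by
    rcases hA with ⟨h1, h2, h3, -, h5⟩ | ⟨h1, h2, h3, -, h5⟩
    · exact fun N => ⟨hD N (h1 N), h2 N, hparam N, h5 N, h3.1 N⟩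
    · exact fun N => ⟨hD N (h1 N), h2 N, hparam N, h5 N,
        (h3 N).mono fun ω hω j hj => (hω j hj).1⟩
  have hbm : 0 < bmax := hbmin.trans_le hb
  -- `n` is deterministic, so a single sample point suffices.
  have hn : Tendsto n atTop atTop := by
    obtain ⟨ω, hω⟩ := hmin.exists
    exact tendsto_atTop_mono (fun N => min_le_right _ _) hω
  exact ⟨⟨fun N => (M N).integrable_fdpOra hτ hν.2,
      FAT.limsup_fdrOra_le hadm hbmin hbm hτ hν hn hlog hmin⟩,
    ⟨fun N => (M N).integrable_powOra hτ hν.2,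
      FAT.tendsto_integral_powOra hadm hbmin hbm hτ hν hn hlog hmin⟩⟩
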